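/- Let $n\ge 1$, $X=\{1,\dots,n\}$, and let $X'=\{1',\dots,n'\}$ be a disjoint copy of $X$. Consider partitions of $X\cup X'$ into nonempty blocks. A block is a *point* if it has one element, and a *generalised line* if it meets both $X$ and $X'$. The *rank* of a partition is the number of its generalised lines. *The semigroups.* $\mathcal I^*_n$ (the dual symmetric inverse monoid) is the set of partitions all of whose blocks are generalised lines. The product $\alpha\beta$ is obtained by stacking $\alpha$ over $\beta$, identifying the bottom vertices of $\alpha$ with the top vertices of $\beta$, and recording which of the outer vertices are connected. $\mathcal{PI}^*_n$ is the set of partitions all of whose blocks are points or generalised lines. For $\alpha\in\mathcal{PI}^*_n$ let $\bar\alpha\in\mathcal I^*_{X\cup\{\bar x\}}$ be the partition whose blocks are the generalised lines of $\alpha$ and one more block consisting of $\bar x$, $\bar x'$ and all points of $\alpha$; the product $\alpha\star\beta$ on $\mathcal{PI}^*_n$ is the element with $\overline{\alpha\star\beta}=\bar\alpha\,\bar\beta$. The semigroup $\overline{\mathcal{PI}^*}_n$ has the same carrier as $\mathcal{PI}^*_n$ and the product $\circ$: the generalised lines of $\alpha\circ\beta$ are the sets $(A\cap X)\cup(B\cap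 X')$, where $A$, $B$ are generalised lines of $\alpha$, $\beta$ with $A\cap X'=(B\cap X)'$, and all other vertices are points. All three are inverse semigroups; $\alpha^{-1}$ is obtained from $\alpha$ by exchanging $x$ and $x'$ for all $x\in X$. *The relations.* Let $S$ be one of these semigroups, $E$ its set of idempotents, $\iota$ an identity relation, $I_k=\{a\in S:\operatorname{rank}a\le k\}$, and $E^{(k)}=E\cap I_k$. For $e\in E$ of rank $m$ with generalised lines $E_i\cup E_i'$ $(1\le i\le m)$ and $A\lhd\mathcal S_m$, let $A_e$ be the copy of $A$ in the maximal subgroup $H_e\cong\mathcal S_m$, that is, the set of elements of $H_e$ with generalised lines $E_i\cup E_{\pi(i)}'$ $(1\le i\le m)$, $\pi\in A$; let $N_m(A)$ be the union of the sets $A_e$ over all $e\in E$ of rank $m$. For $A\lhd\mathcal S_{k+1}$ let $F_k(A)$ be the set of pairs $(x,y)$ of elements of rank $k+1$ with $x\,\mathcal H\,y$ and $xy^{-1}\in N_{k+1}(A)$, and put $$\rho_{k,A}=\iota_S\cup F_k(A)\cup(I_k\times I_k).$$ *Congruence pairs.* A subsemigroup $K$ of $S$ is normal if $E\subseteq K$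 and $s^{-1}Ks\subseteq K$ for all $s\in S$. A congruence $\Lambda$ on $E$ is normal if $e\,\Lambda\,f$ implies $s^{-1}es\,\Lambda\,s^{-1}fs$ for all $s\in S$. For a normal subsemigroup $K$ and a normal congruence $\Lambda$, $(K,\Lambda)$ is a congruence pair if (i) for $a\in S$ and $e\in E$, $ae\in K$ and $e\,\Lambda\,a^{-1}a$ imply $a\in K$; (ii) $k\in K$ implies $kk^{-1}\,\Lambda\,k^{-1}k$. **Theorem.** 1. A relation $\rho$ on $\mathcal I^*_n$ is a congruence if and only if $\rho=\rho_{k,A}$ for some $1\le k\le n$ and some $A\lhd\mathcal S_{k+1}$. 2. Let $K$ be a normal subsemigroup of $\mathcal I^*_n$ and $\Lambda$ a normal congruence on its idempotents. Then $(K,\Lambda)$ is a congruence pair if and only if there are $1\le k\le n$ and $A\lhd\mathcal S_{k+1}$ with $\Lambda=\iota_E\cup(E^{(k)}\times E^{(k)})$ and $K=E\cup N_{k+1}(A)\cup I_k$. 3. Let $K$ be a normal subsemigroup of $\mathcal{PI}^*_n$ and $\Lambda$ a normal congruence on its idempotents. Then $(K,\Lambda)$ is a congruence pair if and only if there are $0\le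 k\le n$ and $A\lhd\mathcal S_{k+1}$ with $\Lambda=\iota_E\cup(E^{(k)}\times E^{(k)})$ and $K=E\cup N_{k+1}(A)\cup I_k$. 4. A relation $\rho$ on $\mathcal{PI}^*_n$ is a congruence if and only if $\rho=\rho_{k,A}$ for some $0\le k\le n$ and some $A\lhd\mathcal S_{k+1}$. 5. A relation $\rho$ on $\overline{\mathcal{PI}^*}_n$ is a congruence if and only if $\rho=\rho_{k,A}$ for some $0\le k\le n$ and some $A\lhd\mathcal S_{k+1}$. 6. The semigroups $\mathcal{PI}^*_n$ and $\overline{\mathcal{PI}^*}_n$ have the same congruences. -/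

import Mathlib

namespace PartitionSemigroups

/-! Partitions of `X ∪ X'` are equivalence relations on `X ⊕ X`: `Sum.inl x` is the top vertex `x`,
and `Sum.inr x` is the bottom vertex `x'`. The blocks are the classes of the relation. -/

section Partitions

variable {X : Type*}

/-- A set of vertices is a generalised line if it meets both `X` and `X'`. -/
def IsGenLine (c : Set (X ⊕ X)) : Prop :=
  (∃ x, Sum.inl x ∈ c) ∧ ∃ y, Sum.inr y ∈ c

/-- The set of generalised lines of a partition. -/
def genLines (α : Setoid (X ⊕ X)) : Set (Set (X ⊕ X)) :=
  {c | c ∈ α.classes ∧ IsGenLine c}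

/-- The rank of a partition: the number of its generalised lines (used for finite `X` only). -/
noncomputable def rank (α : Setoid (X ⊕ X)) : ℕ := (genLines α).ncard

/-- The vertex `p` forms a one-element block of `α`. -/
def IsPoint (α : Setoid (X ⊕ X)) (p : X ⊕ X) : Prop := ∀ q, α p q → q = p

/-- Exchange of the top and the bottom vertices. -/
def flip (α : Setoid (X ⊕ X)) : Setoid (X ⊕ X) := Setoid.comap Sum.swap α

/-- Two vertices of the stacked three-layer diagram (top, middle, bottom) that are joined directly:
by `α` drawn between top and middle, or by `β` drawn between middle and bottom. -/
inductive Stack (α β : Setoid (X ⊕ X)) : X ⊕ (X ⊕ X) → X ⊕ (X ⊕ X) → Prop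
  | upper (p q : X ⊕ X) (h : α p q) : Stack α β (Sum.map id Sum.inl p) (Sum.map id Sum.inl q)
  | lower (p q : X ⊕ X) (h : β p q) : Stack α β (Sum.inr p) (Sum.inr q)

/-- The natural product of partitions: connectedness in the stacked diagram, restricted to the
outer (top and bottom) layers. -/
def natMul (α β : Setoid (X ⊕ X)) : Setoid (X ⊕ X) :=
  Setoid.comap (Sum.map id Sum.inr) (Relation.EqvGen.setoid (Stack α β))

/-- All blocks are generalised lines. -/
def AllGenLines (α : Setoid (X ⊕ X)) : Prop := ∀ c ∈ α.classes, IsGenLine c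

/-- Every block is a point or a generalised line. -/
def PointsOrGenLines (α : Setoid (X ⊕ X)) : Prop :=
  ∀ c ∈ α.classes, (∃ p, c = {p}) ∨ IsGenLine c

theorem allGenLines_iff (α : Setoid (X ⊕ X)) :
    AllGenLines α ↔ ∀ p, (∃ x, α p (Sum.inl x)) ∧ ∃ y, α p (Sum.inr y) := by
  constructor
  · intro h p
    obtain ⟨⟨x, hx⟩, ⟨y, hy⟩⟩ := h _ (Setoid.mem_classes α p)
    exact ⟨⟨x, α.symm' hx⟩, ⟨y, α.symm' hy⟩⟩
  · rintro h c ⟨p, rfl⟩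
    obtain ⟨⟨x, hx⟩, ⟨y, hy⟩⟩ := h p
    exact ⟨⟨x, α.symm' hx⟩, ⟨y, α.symm' hy⟩⟩

theorem pointsOrGenLines_iff (α : Setoid (X ⊕ X)) :
    PointsOrGenLines α ↔
      ∀ p, IsPoint α p ∨ ((∃ x, α p (Sum.inl x)) ∧ ∃ y, α p (Sum.inr y)) := by
  constructor
  · intro h p
    rcases h _ (Setoid.mem_classes α p) with ⟨q, hq⟩ | ⟨⟨x, hx⟩, ⟨y, hy⟩⟩
    · left
      have hp : p = q := by
        have : p ∈ {x | α x p} := α.refl' p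
        rw [hq] at this
        exact this
      intro r hr
      have : r ∈ {x | α x p} := α.symm' hr
      rw [hq] at this
      exact this.trans hp.symm
    · exact Or.inr ⟨⟨x, α.symm' hx⟩, ⟨y, α.symm' hy⟩⟩
  · rintro h c ⟨p, rfl⟩
    rcases h p with hp | ⟨⟨x, hx⟩, ⟨y, hy⟩⟩
    · left
      refine ⟨p, Set.ext fun q => ⟨fun hq => hp q (α.symm' hq), ?_⟩⟩
      rintro rfl
      exact α.refl' _
    · exact Or.inr ⟨⟨x, α.symm' hx⟩, ⟨y, α.symm' hy⟩⟩

theorem allGenLines_flip {α : Setoid (X ⊕ X)} (h : AllGenLines α) : AllGenLines (flip α) := by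
  rw [allGenLines_iff] at h ⊢
  intro p
  exact ⟨(h p.swap).2, (h p.swap).1⟩

theorem pointsOrGenLines_flip {α : Setoid (X ⊕ X)} (h : PointsOrGenLines α) :
    PointsOrGenLines (flip α) := by
  rw [pointsOrGenLines_iff] at h ⊢
  intro p
  rcases h p.swap with hp | hp
  · left
    intro q hq
    have := congrArg Sum.swap (hp q.swap hq)
    simpa using this
  · exact Or.inr ⟨hp.2, hp.1⟩

theorem allGenLines_natMul {α β : Setoid (X ⊕ X)} (hα : AllGenLines α) (hβ : AllGenLines β) :
    AllGenLines (natMul α β) := by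
  rw [allGenLines_iff] at hα hβ ⊢
  rintro (x | y)
  · refine ⟨⟨x, Setoid.refl' _ _⟩, ?_⟩
    obtain ⟨m, hm⟩ := (hα (Sum.inl x)).2
    obtain ⟨z, hz⟩ := (hβ (Sum.inl m)).2
    exact ⟨z, Relation.EqvGen.trans _ _ _ (Relation.EqvGen.rel _ _ (Stack.upper _ _ hm))
      (Relation.EqvGen.rel _ _ (Stack.lower _ _ hz))⟩
  · refine ⟨?_, ⟨y, Setoid.refl' _ _⟩⟩
    obtain ⟨m, hm⟩ := (hβ (Sum.inr y)).1
    obtain ⟨z, hz⟩ := (hα (Sum.inr m)).1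
    exact ⟨z, Relation.EqvGen.trans _ _ _ (Relation.EqvGen.rel _ _ (Stack.lower _ _ hm))
      (Relation.EqvGen.rel _ _ (Stack.upper _ _ hz))⟩

/-- The vertices of `α`, as vertices over the set `X ∪ {x̄}`; the new element `x̄` is `none`. -/
def emb : X ⊕ X → Option X ⊕ Option X := Sum.map some some

theorem emb_injective : Function.Injective (emb : X ⊕ X → Option X ⊕ Option X) :=
  Function.Injective.sumMap (Option.some_injective X) (Option.some_injective X)

/-- The vertices `x̄`, `x̄'` and all points of `α`. -/
def Extra (α : Setoid (X ⊕ X)) (P : Option X ⊕ Option X) : Prop :=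
  P = Sum.inl none ∨ P = Sum.inr none ∨ ∃ p, P = emb p ∧ IsPoint α p

theorem extra_emb {α : Setoid (X ⊕ X)} {p : X ⊕ X} : Extra α (emb p) ↔ IsPoint α p := by
  constructor
  · rintro (h | h | ⟨q, hq, hp⟩)
    · cases p <;> simp [emb] at h
    · cases p <;> simp [emb] at h
    · rwa [emb_injective hq]
  · intro h
    exact Or.inr (Or.inr ⟨p, rfl, h⟩)

theorem emb_or_extra (α : Setoid (X ⊕ X)) (P : Option X ⊕ Option X) :
    (∃ p, P = emb p) ∨ Extra α P := by
  rcases P with (_ | x) | (_ | x)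
  · exact Or.inr (Or.inl rfl)
  · exact Or.inl ⟨Sum.inl x, rfl⟩
  · exact Or.inr (Or.inr (Or.inl rfl))
  · exact Or.inl ⟨Sum.inr x, rfl⟩

/-- The partition `ᾱ` over `X ∪ {x̄}`: its blocks are the blocks of `α` that are not points, and one
more block that consists of `x̄`, `x̄'` and all points of `α`. -/
def bar (α : Setoid (X ⊕ X)) : Setoid (Option X ⊕ Option X) where
  r P Q := (Extra α P ∧ Extra α Q) ∨ ∃ p q, P = emb p ∧ Q = emb q ∧ α p q
  iseqv := by
    have key : ∀ {p q : X ⊕ X}, α p q → IsPoint α p → IsPoint α q := by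
      intro p q h hp
      rwa [hp q h]
    refine ⟨?_, ?_, ?_⟩
    · intro P
      rcases emb_or_extra α P with ⟨p, rfl⟩ | h
      · exact Or.inr ⟨p, p, rfl, rfl, α.refl' p⟩
      · exact Or.inl ⟨h, h⟩
    · rintro P Q (⟨h, h'⟩ | ⟨p, q, hp, hq, h⟩)
      · exact Or.inl ⟨h', h⟩
      · exact Or.inr ⟨q, p, hq, hp, α.symm' h⟩
    · rintro P Q R (⟨h, h'⟩ | ⟨p, q, rfl, rfl, h⟩) (⟨k, k'⟩ | ⟨q', r, hq', rfl, k⟩)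
      · exact Or.inl ⟨h, k'⟩
      · subst hq'
        exact Or.inl ⟨h, extra_emb.2 (key k (extra_emb.1 h'))⟩
      · exact Or.inl ⟨extra_emb.2 (key (α.symm' h) (extra_emb.1 k)), k'⟩
      · cases emb_injective hq'
        exact Or.inr ⟨p, r, rfl, rfl, α.trans' h k⟩

theorem bar_none (α : Setoid (X ⊕ X)) : bar α (Sum.inl none) (Sum.inr none) :=
  Or.inl ⟨Or.inl rfl, Or.inr (Or.inl rfl)⟩

theorem allGenLines_bar {α : Setoid (X ⊕ X)} (h : PointsOrGenLines α) : AllGenLines (bar α) := by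
  rw [allGenLines_iff]
  rw [pointsOrGenLines_iff] at h
  have hx : ∀ P, Extra α P → (∃ x, bar α P (Sum.inl x)) ∧ ∃ y, bar α P (Sum.inr y) :=
    fun P hP => ⟨⟨none, Or.inl ⟨hP, Or.inl rfl⟩⟩, ⟨none, Or.inl ⟨hP, Or.inr (Or.inl rfl)⟩⟩⟩
  intro P
  rcases emb_or_extra α P with ⟨p, rfl⟩ | hP
  · rcases h p with hp | ⟨⟨x, hx⟩, ⟨y, hy⟩⟩
    · exact hx _ (extra_emb.2 hp)
    · exact ⟨⟨some x, Or.inr ⟨p, Sum.inl x, rfl, rfl, hx⟩⟩,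
        ⟨some y, Or.inr ⟨p, Sum.inr y, rfl, rfl, hy⟩⟩⟩
  · exact hx P hP

/-- The inverse of `α ↦ ᾱ`: remove `x̄` and `x̄'`, and turn the other elements of the block of `x̄`
into points. -/
def unbar (γ : Setoid (Option X ⊕ Option X)) : Setoid (X ⊕ X) where
  r p q := p = q ∨ (γ (emb p) (emb q) ∧ ¬ γ (emb p) (Sum.inl none))
  iseqv := by
    refine ⟨fun p => Or.inl rfl, ?_, ?_⟩
    · rintro p q (rfl | ⟨h, h'⟩)
      · exact Or.inl rfl
      · exact Or.inr ⟨γ.symm' h, fun k => h' (γ.trans' h k)⟩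
    · rintro p q r (rfl | ⟨h, h'⟩) (rfl | ⟨k, k'⟩)
      · exact Or.inl rfl
      · exact Or.inr ⟨k, k'⟩
      · exact Or.inr ⟨h, h'⟩
      · exact Or.inr ⟨γ.trans' h k, h'⟩

theorem unbar_bar (α : Setoid (X ⊕ X)) : unbar (bar α) = α := by
  have hb : ∀ p : X ⊕ X, bar α (emb p) (Sum.inl none) ↔ IsPoint α p := by
    intro p
    constructor
    · rintro (⟨h, -⟩ | ⟨_, q, _, hq, _⟩)
      · exact extra_emb.1 h
      · cases q <;> simp [emb] at hq
    · intro h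
      exact Or.inl ⟨extra_emb.2 h, Or.inl rfl⟩
  ext p q
  change (p = q ∨ (bar α (emb p) (emb q) ∧ ¬ bar α (emb p) (Sum.inl none))) ↔ α p q
  rw [hb]
  constructor
  · rintro (rfl | ⟨⟨h, -⟩ | ⟨p', q', hp, hq, h⟩, h'⟩)
    · exact α.refl' _
    · exact absurd (extra_emb.1 h) h'
    · rw [emb_injective hp, emb_injective hq]
      exact h
  · intro h
    by_cases hp : IsPoint α p
    · exact Or.inl (hp q h).symm
    · exact Or.inr ⟨Or.inr ⟨p, q, rfl, rfl, h⟩, hp⟩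

theorem pointsOrGenLines_unbar {γ : Setoid (Option X ⊕ Option X)} (h : AllGenLines γ)
    (h0 : γ (Sum.inl none) (Sum.inr none)) : PointsOrGenLines (unbar γ) := by
  rw [pointsOrGenLines_iff]
  rw [allGenLines_iff] at h
  intro p
  by_cases hp : γ (emb p) (Sum.inl none)
  · left
    rintro q (rfl | ⟨-, h'⟩)
    · rfl
    · exact absurd hp h'
  · right
    obtain ⟨⟨x, hx⟩, ⟨y, hy⟩⟩ := h (emb p)
    constructor
    · rcases x with _ | x
      · exact absurd hx hp
      · exact ⟨x, Or.inr ⟨hx, hp⟩⟩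
    · rcases y with _ | y
      · exact absurd (γ.trans' hy (γ.symm' h0)) hp
      · exact ⟨y, Or.inr ⟨hy, hp⟩⟩

/-- The product `α ⋆ β` of partitions into points and generalised lines: the partition whose image
under `γ ↦ γ̄` is the natural product `ᾱ β̄`. -/
def starMul (α β : Setoid (X ⊕ X)) : Setoid (X ⊕ X) := unbar (natMul (bar α) (bar β))

theorem natMul_bar_none (α β : Setoid (X ⊕ X)) :
    natMul (bar α) (bar β) (Sum.inl none) (Sum.inr none) :=
  Relation.EqvGen.trans _ _ _
    (Relation.EqvGen.rel _ _ (Stack.upper _ _ (bar_none α)))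
    (Relation.EqvGen.rel _ _ (Stack.lower _ _ (bar_none β)))

theorem pointsOrGenLines_starMul {α β : Setoid (X ⊕ X)} (hα : PointsOrGenLines α)
    (hβ : PointsOrGenLines β) : PointsOrGenLines (starMul α β) :=
  pointsOrGenLines_unbar (allGenLines_natMul (allGenLines_bar hα) (allGenLines_bar hβ))
    (natMul_bar_none α β)

theorem bar_unbar {γ : Setoid (Option X ⊕ Option X)} (h : AllGenLines γ)
    (h0 : γ (Sum.inl none) (Sum.inr none)) : bar (unbar γ) = γ := by
  have hu : ∀ p, IsPoint (unbar γ) p ↔ γ (emb p) (Sum.inl none) := by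
    rw [allGenLines_iff] at h
    intro p
    constructor
    · intro hp
      by_contra hn
      obtain ⟨⟨x, hx⟩, ⟨y, hy⟩⟩ := h (emb p)
      rcases x with _ | x
      · exact hn hx
      rcases y with _ | y
      · exact hn (γ.trans' hy (γ.symm' h0))
      have h1 := hp (Sum.inl x) (Or.inr ⟨hx, hn⟩)
      have h2 := hp (Sum.inr y) (Or.inr ⟨hy, hn⟩)
      rw [← h1] at h2
      cases h2
    · rintro hp q (rfl | ⟨-, h'⟩)
      · rfl
      · exact absurd hp h'
  have he : ∀ P, Extra (unbar γ) P ↔ γ P (Sum.inl none) := by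
    intro P
    rcases emb_or_extra (unbar γ) P with ⟨p, rfl⟩ | hP
    · rw [extra_emb, hu]
    · refine ⟨fun _ => ?_, fun _ => hP⟩
      rcases hP with rfl | rfl | ⟨p, rfl, hp⟩
      · exact γ.refl' _
      · exact γ.symm' h0
      · exact (hu p).1 hp
  ext P Q
  change ((Extra (unbar γ) P ∧ Extra (unbar γ) Q) ∨
    ∃ p q, P = emb p ∧ Q = emb q ∧ unbar γ p q) ↔ γ P Q
  rw [he, he]
  constructor
  · rintro (⟨h1, h2⟩ | ⟨p, q, rfl, rfl, (rfl | h1)⟩)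
    · exact γ.trans' h1 (γ.symm' h2)
    · exact γ.refl' _
    · exact h1.1
  · intro hPQ
    by_cases hP : γ P (Sum.inl none)
    · exact Or.inl ⟨hP, γ.trans' (γ.symm' hPQ) hP⟩
    · right
      have hQ : ¬ γ Q (Sum.inl none) := fun k => hP (γ.trans' hPQ k)
      rcases emb_or_extra (unbar γ) P with ⟨p, rfl⟩ | k
      · rcases emb_or_extra (unbar γ) Q with ⟨q, rfl⟩ | k
        · exact ⟨p, q, rfl, rfl, Or.inr ⟨hPQ, hP⟩⟩
        · exact absurd ((he Q).1 k) hQ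
      · exact absurd ((he P).1 k) hP

/-- `A ∩ X' = (B ∩ X)'`. -/
def Fits (A B : Set (X ⊕ X)) : Prop := ∀ x, Sum.inr x ∈ A ↔ Sum.inl x ∈ B

/-- `(A ∩ X) ∪ (B ∩ X')`. -/
def join (A B : Set (X ⊕ X)) : Set (X ⊕ X) :=
  {p | (∃ x, p = Sum.inl x ∧ p ∈ A) ∨ ∃ y, p = Sum.inr y ∧ p ∈ B}

theorem classes_eq {α : Setoid (X ⊕ X)} {A A' : Set (X ⊕ X)} (hA : A ∈ α.classes)
    (hA' : A' ∈ α.classes) {p : X ⊕ X} (hp : p ∈ A) (hp' : p ∈ A') : A = A' := by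
  obtain ⟨a, rfl⟩ := hA
  obtain ⟨b, rfl⟩ := hA'
  have hab : α a b := α.trans' (α.symm' hp) hp'
  ext q
  exact ⟨fun h => α.trans' h hab, fun h => α.trans' h (α.symm' hab)⟩

/-- The product `α ∘ β`: its generalised lines are the sets `(A ∩ X) ∪ (B ∩ X')`, where `A` and `B`
are generalised lines of `α` and `β` with `A ∩ X' = (B ∩ X)'`; all other vertices are points. -/
def circMul (α β : Setoid (X ⊕ X)) : Setoid (X ⊕ X) where
  r p q := p = q ∨ ∃ A ∈ genLines α, ∃ B ∈ genLines β, Fits A B ∧ p ∈ join A B ∧ q ∈ join A B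
  iseqv := by
    refine ⟨fun p => Or.inl rfl, ?_, ?_⟩
    · rintro p q (rfl | ⟨A, hA, B, hB, h, hp, hq⟩)
      · exact Or.inl rfl
      · exact Or.inr ⟨A, hA, B, hB, h, hq, hp⟩
    · rintro p q r (rfl | ⟨A, hA, B, hB, h, hp, hq⟩) (rfl | ⟨A', hA', B', hB', h', hq', hr⟩)
      · exact Or.inl rfl
      · exact Or.inr ⟨A', hA', B', hB', h', hq', hr⟩
      · exact Or.inr ⟨A, hA, B, hB, h, hp, hq⟩
      · have hAB : A = A' ∧ B = B' := by
          rcases hq with ⟨x, rfl, hx⟩ | ⟨y, rfl, hy⟩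
          · rcases hq' with ⟨x', -, hx'⟩ | ⟨y, hy, -⟩
            · have e := classes_eq hA.1 hA'.1 hx hx'
              subst e
              obtain ⟨m, hm⟩ := hA.2.2
              exact ⟨rfl, classes_eq hB.1 hB'.1 ((h m).1 hm) ((h' m).1 hm)⟩
            · cases hy
          · rcases hq' with ⟨x, hx, -⟩ | ⟨y', -, hy'⟩
            · cases hx
            · have e := classes_eq hB.1 hB'.1 hy hy'
              subst e
              obtain ⟨m, hm⟩ := hB.2.1
              exact ⟨classes_eq hA.1 hA'.1 ((h m).2 hm) ((h' m).2 hm), rfl⟩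
        obtain ⟨rfl, rfl⟩ := hAB
        exact Or.inr ⟨A, hA, B, hB, h, hp, hr⟩

theorem pointsOrGenLines_circMul (α β : Setoid (X ⊕ X)) : PointsOrGenLines (circMul α β) := by
  rw [pointsOrGenLines_iff]
  intro p
  by_cases hp : IsPoint (circMul α β) p
  · exact Or.inl hp
  · right
    simp only [IsPoint, not_forall] at hp
    obtain ⟨q, hq, hne⟩ := hp
    rcases hq with rfl | ⟨A, hA, B, hB, h, hp, -⟩
    · exact absurd rfl hne
    · obtain ⟨x, hx⟩ := hA.2.1
      obtain ⟨y, hy⟩ := hB.2.2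
      exact ⟨⟨x, Or.inr ⟨A, hA, B, hB, h, hp, Or.inl ⟨x, rfl, hx⟩⟩⟩,
        ⟨y, Or.inr ⟨A, hA, B, hB, h, hp, Or.inr ⟨y, rfl, hy⟩⟩⟩⟩

/-- The property by which `α ∘ β` is determined among the partitions into points and generalised
lines. -/
theorem circMul_inl_inr (α β : Setoid (X ⊕ X)) (i j : X) :
    circMul α β (Sum.inl i) (Sum.inr j) ↔
      ∃ A ∈ genLines α, ∃ B ∈ genLines β, Sum.inl i ∈ A ∧ Sum.inr j ∈ B ∧ Fits A B := by
  constructor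
  · rintro (h | ⟨A, hA, B, hB, h, hi, hj⟩)
    · cases h
    · refine ⟨A, hA, B, hB, ?_, ?_, h⟩
      · rcases hi with ⟨x, -, hx⟩ | ⟨y, hy, -⟩
        · exact hx
        · cases hy
      · rcases hj with ⟨x, hx, -⟩ | ⟨y, -, hy⟩
        · cases hx
        · exact hy
  · rintro ⟨A, hA, B, hB, hi, hj, h⟩
    exact Or.inr ⟨A, hA, B, hB, h, Or.inl ⟨i, rfl, hi⟩, Or.inr ⟨j, rfl, hj⟩⟩

end Partitions

/-! ### The three semigroups -/

/-- The dual symmetric inverse semigroup `I*_X`: all blocks are generalised lines, with the natural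
multiplication. -/
def IStar (X : Type*) := {α : Setoid (X ⊕ X) // AllGenLines α}

/-- The semigroup `PI*_X`: all blocks are points or generalised lines, with multiplication `⋆`. -/
def PIStar (X : Type*) := {α : Setoid (X ⊕ X) // PointsOrGenLines α}

/-- The semigroup with the same carrier as `PI*_X` and with multiplication `∘`. -/
def PIBar (X : Type*) := {α : Setoid (X ⊕ X) // PointsOrGenLines α}

instance (X : Type*) : Mul (IStar X) :=
  ⟨fun α β => ⟨natMul α.1 β.1, allGenLines_natMul α.2 β.2⟩⟩

instance (X : Type*) : Mul (PIStar X) :=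
  ⟨fun α β => ⟨starMul α.1 β.1, pointsOrGenLines_starMul α.2 β.2⟩⟩

instance (X : Type*) : Mul (PIBar X) :=
  ⟨fun α β => ⟨circMul α.1 β.1, pointsOrGenLines_circMul α.1 β.1⟩⟩

/-! The semigroup inverse of `{A_i ∪ B_i'}` is `{B_i ∪ A_i'}` in each of the three semigroups. -/

instance (X : Type*) : Inv (IStar X) := ⟨fun α => ⟨flip α.1, allGenLines_flip α.2⟩⟩

instance (X : Type*) : Inv (PIStar X) := ⟨fun α => ⟨flip α.1, pointsOrGenLines_flip α.2⟩⟩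

instance (X : Type*) : Inv (PIBar X) := ⟨fun α => ⟨flip α.1, pointsOrGenLines_flip α.2⟩⟩

/-- The identity map between the common carriers of the two semigroups. -/
def PIStar.toBar {X : Type*} : PIStar X ≃ PIBar X := Equiv.refl _

/-- Semigroups whose elements are partitions of `X ∪ X'`. -/
class PartitionLike (S : Type*) (X : outParam Type*) where
  /-- the partition -/
  part : S → Setoid (X ⊕ X)

instance (X : Type*) : PartitionLike (IStar X) X := ⟨Subtype.val⟩

instance (X : Type*) : PartitionLike (PIStar X) X := ⟨Subtype.val⟩

instance (X : Type*) : PartitionLike (PIBar X) X := ⟨Subtype.val⟩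

/-- The rank of an element. -/
noncomputable def rk {S X : Type*} [PartitionLike S X] (s : S) : ℕ := rank (PartitionLike.part s)

/-! ### Notions for semigroups with an inverse operation -/

section Semigroups

variable {S : Type*} [Mul S]

/-- Green's relation `R`: `a S¹ = b S¹`. -/
def GreenR (a b : S) : Prop := a = b ∨ ((∃ u, a = b * u) ∧ ∃ v, b = a * v)

/-- Green's relation `L`: `S¹ a = S¹ b`. -/
def GreenL (a b : S) : Prop := a = b ∨ ((∃ u, a = u * b) ∧ ∃ v, b = v * a)

/-- Green's relation `H`. -/
def GreenH (a b : S) : Prop := GreenR a b ∧ GreenL a b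

/-- The relation `ρ` is a congruence. -/
def IsCongruence (ρ : S → S → Prop) : Prop := ∃ c : Con S, ∀ a b, c a b ↔ ρ a b

variable [Inv S]

/-- A normal subsemigroup: it contains all idempotents and is closed under `x ↦ s⁻¹ x s`. -/
def IsNormalSubsemigroup (K : Subsemigroup S) : Prop :=
  (∀ e : S, IsIdempotentElem e → e ∈ K) ∧ ∀ s : S, ∀ x ∈ K, s⁻¹ * x * s ∈ K

/-- A normal congruence on the semilattice `E(S)`; it is given as a set of pairs of elements of `S`
that consists of pairs of idempotents. -/
structure IsNormalCongruence (Λ : S → S → Prop) : Prop where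
  idem : ∀ e f, Λ e f → IsIdempotentElem e ∧ IsIdempotentElem f
  refl : ∀ e, IsIdempotentElem e → Λ e e
  symm : ∀ e f, Λ e f → Λ f e
  trans : ∀ e f g, Λ e f → Λ f g → Λ e g
  mul : ∀ e f g h, Λ e f → Λ g h → Λ (e * g) (f * h)
  conj : ∀ s e f, Λ e f → Λ (s⁻¹ * e * s) (s⁻¹ * f * s)

/-- A congruence pair. -/
structure IsCongruencePair (K : Subsemigroup S) (Λ : S → S → Prop) : Prop where
  normalSubsemigroup : IsNormalSubsemigroup K
  normalCongruence : IsNormalCongruence Λ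
  mem_of_mul_mem : ∀ a e, IsIdempotentElem e → a * e ∈ K → Λ e (a⁻¹ * a) → a ∈ K
  mul_inv_rel : ∀ k ∈ K, Λ (k * k⁻¹) (k⁻¹ * k)

end Semigroups

/-! ### The relations in the classification -/

section Classification

variable (S : Type*) {X : Type*} [Mul S] [PartitionLike S X]

/-- The ideal of all elements of rank at most `k`. -/
def rankIdeal (k : ℕ) : Set S := {a | rk a ≤ k}

/-- The idempotents of rank at most `k`. -/
def rankIdempotents (k : ℕ) : Set S := {e | IsIdempotentElem e ∧ rk e ≤ k}

variable {S}

/-- The copy `A_e` of `A ◁ S_k` in the maximal subgroup `H_e`, where `e = {E_i ∪ E_i'}` is an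
idempotent of rank `k`: all elements `{E_i ∪ E_{π i}'}` with `π ∈ A`. As `A` is normal, it does not
depend on the numbering `E_1, …, E_k` of the blocks. -/
def groupCopy {k : ℕ} (A : Subgroup (Equiv.Perm (Fin k))) (e : S) : Set S :=
  {x | GreenH x e ∧ ∃ E : Fin k ≃ ↥(genLines (PartitionLike.part e)), ∃ π ∈ A,
    ∀ i : Fin k, ∀ a b : X, Sum.inl a ∈ (E i : Set (X ⊕ X)) →
      Sum.inr b ∈ (E (π i) : Set (X ⊕ X)) → PartitionLike.part x (Sum.inl a) (Sum.inr b)}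

variable (S)

/-- The set `N_k(A)`: the union of the groups `A_e` over all idempotents `e` of rank `k`. -/
def normalPart {k : ℕ} (A : Subgroup (Equiv.Perm (Fin k))) : Set S :=
  {x | ∃ e : S, IsIdempotentElem e ∧ rk e = k ∧ x ∈ groupCopy A e}

variable [Inv S]

/-- The relation `F_k(A)` on the elements of rank `k + 1`. -/
def relF {k : ℕ} (A : Subgroup (Equiv.Perm (Fin (k + 1)))) (x y : S) : Prop :=
  rk x = k + 1 ∧ rk y = k + 1 ∧ GreenH x y ∧ x * y⁻¹ ∈ normalPart S A

/-- The relation `ρ_{k,A}`. -/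
def relRho {k : ℕ} (A : Subgroup (Equiv.Perm (Fin (k + 1)))) (x y : S) : Prop :=
  x = y ∨ relF S A x y ∨ (x ∈ rankIdeal S k ∧ y ∈ rankIdeal S k)

/-- The relation `ι ∪ (E^(k) × E^(k))` on the idempotents. -/
def relLambda (k : ℕ) (e f : S) : Prop :=
  (IsIdempotentElem e ∧ e = f) ∨ (e ∈ rankIdempotents S k ∧ f ∈ rankIdempotents S k)

/-- The set `E ∪ N_{k+1}(A) ∪ I_k`. -/
def kernelSet {k : ℕ} (A : Subgroup (Equiv.Perm (Fin (k + 1)))) : Set S :=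
  {e | IsIdempotentElem e} ∪ normalPart S A ∪ rankIdeal S k

end Classification

end PartitionSemigroups

/-! Write `[E; F]` for the partition whose generalised lines are numbered by labellings ("frames")
`E` of the upper and `F` of the lower vertices. In all three semigroups `[E; F][F; G] = [E; G]` and
`[E; F]⁻¹ = [F; E]`. A symbol is unique up to a common renumbering of `E` and `F`, and the H-class
of `[E; F]` consists of the elements `[E; πF]`. Hence idempotents of equal rank are conjugate, and
all maximal subgroups are symmetric groups. Beyond this calculus, recorded in `FramedSemigroup`, two
facts are needed. Below an idempotent of rank `m + 1` lies one of rank `m`, as long as `m` is at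
least the minimal rank (1 for `IStar`, 0 otherwise). If `m` exceeds the minimal rank, a nontrivial
element of the group of such an idempotent moves an idempotent of rank `m` below it. The lower
idempotents arise by merging two lines in `IStar`, and by dropping a line in the other two
semigroups.

A congruence on an inverse semigroup is determined by its trace on the idempotents and its kernel,
which form a congruence pair (`con_iff_kernel_trace`). For the trace: if `e` is related to some `f <
e`, then multiplication by lower idempotents `g ≠ f` relates ever smaller ones, until `e` is related
to the unique idempotent of minimal rank (`IsNormalCongruence.exists_rel_minRank`). Conjugation then
collapses everything of rank at most `rk e`, so the trace is `relLambda` for some `k`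
(`IsNormalCongruence.eq_relLambda`).

For the kernel: an element of rank above `k` lies in a group. If the rank exceeds `k + 1` and the
element is not idempotent, it moves an idempotent of rank above `k`, which contradicts the pair
axioms. In rank `k + 1` normality leaves one normal subgroup `A`, the same for all idempotents; in
rank at most `k` axiom (i) forces every element in (`IsCongruencePair.eq_kernelSet`). Conversely,
`relRho` is checked to be a congruence by the calculus of frames. The description of `relRho` by
frames does not mention the product, so `PIStar` and `PIBar` have the same congruences. -/

namespace PartitionSemigroups

/-! ### Inverse semigroups -/

/-- Inverse semigroups, with the inverse as an operation. -/
class InverseSemigroup (S : Type*) extends Semigroup S, Inv S where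
  mul_inv_mul : ∀ x : S, x * x⁻¹ * x = x
  inv_involutive : ∀ x : S, x⁻¹⁻¹ = x
  inv_mul_rev : ∀ x y : S, (x * y)⁻¹ = y⁻¹ * x⁻¹
  range_comm : ∀ x y : S, x * x⁻¹ * (y * y⁻¹) = y * y⁻¹ * (x * x⁻¹)

/-- A semigroup of bi-unique relations that is closed under converses is an inverse semigroup. -/
abbrev InverseSemigroup.ofRelations {S T : Type*} [Mul S] [Inv S] (R : S → T → T → Prop)
    (ext : ∀ a b, (∀ U V, R a U V ↔ R b U V) → a = b)
    (mul : ∀ a b U W, R (a * b) U W ↔ ∃ V, R a U V ∧ R b V W)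
    (inv : ∀ a U V, R a⁻¹ U V ↔ R a V U)
    (unique : ∀ a U V W, R a U V → R a U W → V = W) : InverseSemigroup S where
  mul_assoc a b c := by
    apply ext
    intro U V
    simp only [mul]
    constructor
    · rintro ⟨W, ⟨Z, h1, h2⟩, h3⟩
      exact ⟨Z, h1, W, h2, h3⟩
    · rintro ⟨Z, h1, W, h2, h3⟩
      exact ⟨W, ⟨Z, h1, h2⟩, h3⟩
  mul_inv_mul a := by
    apply ext
    intro U V
    simp only [mul, inv]
    constructor
    · rintro ⟨W, ⟨Z, h1, h2⟩, h3⟩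
      have := unique a⁻¹ Z U W ((inv _ _ _).2 h1) ((inv _ _ _).2 h2)
      rwa [this]
    · intro h
      exact ⟨U, ⟨V, h, h⟩, h⟩
  inv_involutive a := by
    apply ext
    intro U V
    simp only [inv]
  inv_mul_rev a b := by
    apply ext
    intro U V
    simp only [inv, mul]
    exact exists_congr fun W => and_comm
  range_comm a b := by
    -- The relation of `c * c⁻¹` is the identity on the domain of `c`; partial identities commute.
    have key : ∀ c U V, R (c * c⁻¹) U V ↔ U = V ∧ ∃ W, R c U W := by
      intro c U V
      simp only [mul, inv]
      constructor
      · rintro ⟨W, h1, h2⟩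
        exact ⟨unique c⁻¹ W U V ((inv _ _ _).2 h1) ((inv _ _ _).2 h2), W, h1⟩
      · rintro ⟨rfl, W, h⟩
        exact ⟨W, h, h⟩
    apply ext
    intro U V
    rw [mul, mul]
    simp only [key]
    constructor
    · rintro ⟨W, ⟨rfl, h⟩, rfl, h'⟩
      exact ⟨U, ⟨rfl, h'⟩, rfl, h⟩
    · rintro ⟨W, ⟨rfl, h⟩, rfl, h'⟩
      exact ⟨U, ⟨rfl, h'⟩, rfl, h⟩

section InverseSemigroups

variable {S : Type*} [InverseSemigroup S]

instance : InvolutiveInv S := ⟨InverseSemigroup.inv_involutive⟩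

theorem mul_inv_mul (x : S) : x * (x⁻¹ * x) = x := by
  rw [← mul_assoc, InverseSemigroup.mul_inv_mul]

theorem mul_inv_mul_assoc (x y : S) : x * (x⁻¹ * (x * y)) = x * y := by
  rw [← mul_assoc x⁻¹, ← mul_assoc, mul_inv_mul]

theorem inv_mul_inv (x : S) : x⁻¹ * (x * x⁻¹) = x⁻¹ := by
  simpa using mul_inv_mul x⁻¹

theorem inv_mul_inv_assoc (x y : S) : x⁻¹ * (x * (x⁻¹ * y)) = x⁻¹ * y := by
  simpa using mul_inv_mul_assoc x⁻¹ y

theorem inv_mul_rev (x y : S) : (x * y)⁻¹ = y⁻¹ * x⁻¹ := InverseSemigroup.inv_mul_rev x y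

theorem idem_mul_inv (x : S) : IsIdempotentElem (x * x⁻¹) := by
  rw [IsIdempotentElem, mul_assoc, inv_mul_inv]

theorem idem_inv_mul (x : S) : IsIdempotentElem (x⁻¹ * x) := by
  rw [IsIdempotentElem, mul_assoc, mul_inv_mul]

/-- With `e⁻¹` idempotent as well, the two products of the commuting idempotents `e * e⁻¹` and `e⁻¹
* e` simplify to `e` and `e⁻¹`. -/
theorem idem_inv {e : S} (he : IsIdempotentElem e) : e⁻¹ = e := by
  have h1 : e⁻¹ * e⁻¹ = e⁻¹ := by rw [← inv_mul_rev, he.eq]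
  have h2 := InverseSemigroup.range_comm e e⁻¹
  rw [inv_inv] at h2
  have h3 : e * e⁻¹ * (e⁻¹ * e) = e := by
    rw [mul_assoc, ← mul_assoc e⁻¹ e⁻¹, h1, mul_inv_mul]
  have h4 : e⁻¹ * e * (e * e⁻¹) = e⁻¹ := by
    rw [mul_assoc, ← mul_assoc e e, he.eq, inv_mul_inv]
  rw [h3, h4] at h2
  exact h2.symm

theorem idem_comm {e f : S} (he : IsIdempotentElem e) (hf : IsIdempotentElem f) :
    e * f = f * e := by
  have := InverseSemigroup.range_comm e f
  rwa [idem_inv he, idem_inv hf, he.eq, hf.eq] at this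

theorem idem_mul {e f : S} (he : IsIdempotentElem e) (hf : IsIdempotentElem f) :
    IsIdempotentElem (e * f) := by
  rw [IsIdempotentElem, mul_assoc, ← mul_assoc f, idem_comm hf he, mul_assoc, hf.eq,
    ← mul_assoc, he.eq]

/-- An idempotent can be moved to the other side of any element. -/
theorem idem_mul_eq {e : S} (he : IsIdempotentElem e) (x : S) : e * x = x * (x⁻¹ * e * x) := by
  calc e * x = e * (x * x⁻¹) * x := by rw [mul_assoc, mul_assoc, mul_inv_mul]
    _ = x * (x⁻¹ * e * x) := by
      rw [idem_comm he (idem_mul_inv x)]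
      simp only [mul_assoc]

theorem idem_conj {e : S} (he : IsIdempotentElem e) (x : S) : IsIdempotentElem (x⁻¹ * e * x) := by
  have h := idem_mul_eq he x
  calc x⁻¹ * e * x * (x⁻¹ * e * x) = x⁻¹ * e * (x * (x⁻¹ * e * x)) := by simp only [mul_assoc]
    _ = x⁻¹ * e * x := by rw [← h, mul_assoc, ← mul_assoc e e, he.eq, ← mul_assoc]

theorem greenR_iff {a b : S} : GreenR a b ↔ a * a⁻¹ = b * b⁻¹ := by
  have aux : ∀ {a b u : S}, a = b * u → b * b⁻¹ * (a * a⁻¹) = a * a⁻¹ := by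
    rintro a b u rfl
    rw [← mul_assoc, mul_assoc b b⁻¹, mul_inv_mul_assoc]
  constructor
  · rintro (rfl | ⟨⟨u, hu⟩, v, hv⟩)
    · rfl
    · rw [← aux hu, idem_comm (idem_mul_inv b) (idem_mul_inv a), aux hv]
  · intro h
    refine Or.inr ⟨⟨b⁻¹ * a, ?_⟩, a⁻¹ * b, ?_⟩
    · rw [← mul_assoc, ← h, mul_assoc, mul_inv_mul]
    · rw [← mul_assoc, h, mul_assoc, mul_inv_mul]

theorem greenL_iff {a b : S} : GreenL a b ↔ a⁻¹ * a = b⁻¹ * b := by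
  have : GreenL a b ↔ GreenR a⁻¹ b⁻¹ := by
    have aux : ∀ a b : S, (∃ u, a = u * b) ↔ ∃ u, a⁻¹ = b⁻¹ * u := by
      intro a b
      constructor
      · rintro ⟨u, rfl⟩
        exact ⟨u⁻¹, inv_mul_rev _ _⟩
      · rintro ⟨u, hu⟩
        exact ⟨u⁻¹, by rw [← inv_inv a, hu, inv_mul_rev, inv_inv]⟩
    simp only [GreenL, GreenR, aux, inv_inj]
  rw [this, greenR_iff, inv_inv, inv_inv]

theorem greenH_iff {a b : S} : GreenH a b ↔ a * a⁻¹ = b * b⁻¹ ∧ a⁻¹ * a = b⁻¹ * b := by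
  rw [GreenH, greenR_iff, greenL_iff]

theorem GreenH.symm {x y : S} (h : GreenH x y) : GreenH y x := by
  rw [greenH_iff] at h ⊢
  exact ⟨h.1.symm, h.2.symm⟩

/-! ### Congruences on inverse semigroups -/

/-- Both inverses are related to `x⁻¹ * x * y⁻¹`: replace single factors `x` and `y` by each other
in `x⁻¹xx⁻¹` and in `y⁻¹yy⁻¹`, and let idempotents commute. -/
theorem con_inv (c : Con S) {x y : S} (h : c x y) : c x⁻¹ y⁻¹ := by
  have key : ∀ {x y : S}, c x y → c x⁻¹ (x⁻¹ * x * y⁻¹) := by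
    intro x y h
    have h1 : c x⁻¹ (x⁻¹ * y * y⁻¹ * x * x⁻¹) := by
      have e1 : c (x⁻¹ * x * x⁻¹) (x⁻¹ * y * x⁻¹) := c.mul (c.mul (c.refl _) h) (c.refl _)
      have e2 : c (x⁻¹ * y * (y⁻¹ * y) * x⁻¹) (x⁻¹ * y * (y⁻¹ * x) * x⁻¹) :=
        c.mul (c.mul (c.refl _) (c.mul (c.refl _) (c.symm h))) (c.refl _)
      rw [mul_assoc, inv_mul_inv] at e1
      rw [mul_assoc x⁻¹ y, mul_inv_mul] at e2
      simpa only [mul_assoc] using c.trans e1 e2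
    have h2 : x⁻¹ * y * y⁻¹ * x * x⁻¹ = x⁻¹ * (y * y⁻¹) := by
      calc x⁻¹ * y * y⁻¹ * x * x⁻¹ = x⁻¹ * ((y * y⁻¹) * (x * x⁻¹)) := by simp only [mul_assoc]
        _ = x⁻¹ * (y * y⁻¹) := by
          rw [idem_comm (idem_mul_inv y) (idem_mul_inv x)]
          simp only [mul_assoc, inv_mul_inv_assoc]
    rw [h2] at h1
    have h3 : c (x⁻¹ * (y * y⁻¹)) (x⁻¹ * (x * y⁻¹)) :=
      c.mul (c.refl _) (c.mul (c.symm h) (c.refl _))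
    simpa only [mul_assoc] using c.trans h1 h3
  have k1 := key h
  have k2 : c y⁻¹ (x⁻¹ * x * y⁻¹) := by
    have e1 : c (y⁻¹ * y * y⁻¹) (y⁻¹ * x * y⁻¹) :=
      c.mul (c.mul (c.refl _) (c.symm h)) (c.refl _)
    have e2 : c (y⁻¹ * (x * (x⁻¹ * x)) * y⁻¹) (y⁻¹ * (y * (x⁻¹ * x)) * y⁻¹) :=
      c.mul (c.mul (c.refl _) (c.mul h (c.refl _))) (c.refl _)
    rw [mul_inv_mul] at e2
    have e3 : y⁻¹ * (y * (x⁻¹ * x)) * y⁻¹ = x⁻¹ * x * y⁻¹ := by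
      calc y⁻¹ * (y * (x⁻¹ * x)) * y⁻¹ = (y⁻¹ * y) * (x⁻¹ * x) * y⁻¹ := by simp only [mul_assoc]
        _ = x⁻¹ * x * y⁻¹ := by
          rw [idem_comm (idem_inv_mul y) (idem_inv_mul x), mul_assoc, mul_assoc y⁻¹, inv_mul_inv]
    rw [e3] at e2
    rw [mul_assoc, inv_mul_inv] at e1
    exact c.trans e1 e2
  exact c.trans k1 (c.symm k2)

/-- The kernel of a congruence: the elements related to an idempotent. -/
def conKernel (c : Con S) : Subsemigroup S where
  carrier := {a | ∃ e, IsIdempotentElem e ∧ c a e}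
  mul_mem' := by
    rintro a b ⟨e, he, hae⟩ ⟨f, hf, hbf⟩
    exact ⟨e * f, idem_mul he hf, c.mul hae hbf⟩

/-- The trace of a congruence: its restriction to the idempotents. -/
def conTrace (c : Con S) (e f : S) : Prop := IsIdempotentElem e ∧ IsIdempotentElem f ∧ c e f

theorem conKernel_conTrace_pair (c : Con S) : IsCongruencePair (conKernel c) (conTrace c) where
  normalSubsemigroup := by
    refine ⟨fun e he => ⟨e, he, c.refl e⟩, ?_⟩
    rintro s x ⟨e, he, hxe⟩
    exact ⟨s⁻¹ * e * s, idem_conj he s, c.mul (c.mul (c.refl _) hxe) (c.refl _)⟩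
  normalCongruence :=
    { idem := fun e f h => ⟨h.1, h.2.1⟩
      refl := fun e he => ⟨he, he, c.refl e⟩
      symm := fun e f h => ⟨h.2.1, h.1, c.symm h.2.2⟩
      trans := fun e f g h h' => ⟨h.1, h'.2.1, c.trans h.2.2 h'.2.2⟩
      mul := fun e f g h h1 h2 =>
        ⟨idem_mul h1.1 h2.1, idem_mul h1.2.1 h2.2.1, c.mul h1.2.2 h2.2.2⟩
      conj := fun s e f h =>
        ⟨idem_conj h.1 s, idem_conj h.2.1 s, c.mul (c.mul (c.refl _) h.2.2) (c.refl _)⟩ }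
  mem_of_mul_mem := by
    rintro a e he ⟨f, hf, haf⟩ ⟨-, -, h⟩
    refine ⟨f, hf, c.trans ?_ haf⟩
    have : c (a * (a⁻¹ * a)) (a * e) := c.mul (c.refl _) (c.symm h)
    rwa [mul_inv_mul] at this
  mul_inv_rel := by
    rintro k ⟨e, he, h⟩
    have h' := con_inv c h
    exact ⟨idem_mul_inv k, idem_inv_mul k, c.trans (c.mul h h')
      (c.trans (by rw [idem_inv he]; exact c.refl _) (c.symm (c.mul h' h)))⟩

/-- The half of the kernel-trace correspondence that makes the classification of pairs suffice: a
congruence can be recovered from its pair. -/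
theorem con_iff_kernel_trace (c : Con S) (x y : S) :
    c x y ↔ conTrace c (x⁻¹ * x) (y⁻¹ * y) ∧ x * y⁻¹ ∈ conKernel c := by
  constructor
  · intro h
    exact ⟨⟨idem_inv_mul x, idem_inv_mul y, c.mul (con_inv c h) h⟩,
      y * y⁻¹, idem_mul_inv y, c.mul h (c.refl _)⟩
  · rintro ⟨⟨-, -, h⟩, g, hg, hxy⟩
    -- With `g` an idempotent related to `x * y⁻¹`, the trace gives `x ~ xy⁻¹y ~ gy`, hence `gx ~
    -- x`. Symmetrically, as `g⁻¹ = g`, also `y ~ yx⁻¹x ~ gx`.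
    have h1 : c x (g * y) := by
      have e1 : c (x * (x⁻¹ * x)) (x * (y⁻¹ * y)) := c.mul (c.refl _) h
      have e2 : c (x * y⁻¹ * y) (g * y) := c.mul hxy (c.refl _)
      rw [mul_inv_mul, ← mul_assoc] at e1
      exact c.trans e1 e2
    have h2 : c (g * x) x := by
      have e1 : c (g * x) (g * (g * y)) := c.mul (c.refl _) h1
      rw [← mul_assoc, hg.eq] at e1
      exact c.trans e1 (c.symm h1)
    have h3 : c y (g * x) := by
      have e1 : c (y * (y⁻¹ * y)) (y * (x⁻¹ * x)) := c.mul (c.refl _) (c.symm h)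
      have e2 : c (y * x⁻¹ * x) (g * x) := by
        refine c.mul ?_ (c.refl _)
        have := con_inv c hxy
        rwa [inv_mul_rev, inv_inv, idem_inv hg] at this
      rw [mul_inv_mul, ← mul_assoc] at e1
      exact c.trans e1 e2
    exact c.symm (c.trans h3 h2)

end InverseSemigroups

/-! ### Partitions given by labelled generalised lines -/

section Lines

variable {X Y : Type*}

/-- Every label occurs. -/
def IsFrame (E : X → Option Y) : Prop := ∀ i, ∃ x, E x = some i

/-- The partition whose generalised lines consist of the upper vertices with label `i` under `E` and
the lower vertices with label `i` under `F`; vertices without a label are points. -/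
def lines (E F : X → Option Y) : Setoid (X ⊕ X) where
  r p q := p = q ∨ ∃ i, Sum.elim E F p = some i ∧ Sum.elim E F q = some i
  iseqv := by
    refine ⟨fun p => Or.inl rfl, ?_, ?_⟩
    · rintro p q (rfl | ⟨i, h, h'⟩)
      · exact Or.inl rfl
      · exact Or.inr ⟨i, h', h⟩
    · rintro p q r (rfl | ⟨i, h, h'⟩) (rfl | ⟨j, k, k'⟩)
      · exact Or.inl rfl
      · exact Or.inr ⟨j, k, k'⟩
      · exact Or.inr ⟨i, h, h'⟩
      · obtain rfl : i = j := Option.some.inj (h'.symm.trans k)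
        exact Or.inr ⟨i, h, k'⟩

theorem lines_apply {E F : X → Option Y} {p q : X ⊕ X} :
    lines E F p q ↔ p = q ∨ ∃ i, Sum.elim E F p = some i ∧ Sum.elim E F q = some i := Iff.rfl

theorem lines_inl_inr {E F : X → Option Y} {x y : X} :
    lines E F (Sum.inl x) (Sum.inr y) ↔ ∃ i, E x = some i ∧ F y = some i := by
  simp [lines_apply]

theorem flip_apply {α : Setoid (X ⊕ X)} {p q : X ⊕ X} : flip α p q ↔ α p.swap q.swap := Iff.rfl

theorem flip_lines (E F : X → Option Y) : flip (lines E F) = lines F E := by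
  ext p q
  rw [flip_apply, lines_apply, lines_apply]
  rcases p with p | p <;> rcases q with q | q <;> simp

theorem pointsOrGenLines_lines {E F : X → Option Y} (hE : IsFrame E) (hF : IsFrame F) :
    PointsOrGenLines (lines E F) := by
  rw [pointsOrGenLines_iff]
  intro p
  rcases h : Sum.elim E F p with _ | i
  · left
    rintro q (rfl | ⟨i, hi, -⟩)
    · rfl
    · rw [h] at hi
      cases hi
  · right
    obtain ⟨x, hx⟩ := hE i
    obtain ⟨y, hy⟩ := hF i
    exact ⟨⟨x, Or.inr ⟨i, h, hx⟩⟩, ⟨y, Or.inr ⟨i, h, hy⟩⟩⟩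

theorem allGenLines_lines_iff {E F : X → Option Y} (hE : IsFrame E) (hF : IsFrame F) :
    AllGenLines (lines E F) ↔ (∀ x, E x ≠ none) ∧ ∀ x, F x ≠ none := by
  rw [allGenLines_iff]
  constructor
  · intro h
    constructor
    · intro x hx
      obtain ⟨y, hy⟩ := (h (Sum.inl x)).2
      obtain ⟨i, hi, -⟩ := lines_inl_inr.1 hy
      rw [hx] at hi
      cases hi
    · intro y hy
      obtain ⟨x, hx⟩ := (h (Sum.inr y)).1
      obtain ⟨i, -, hi⟩ := lines_inl_inr.1 ((lines E F).symm' hx)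
      rw [hy] at hi
      cases hi
  · rintro ⟨h1, h2⟩ p
    obtain ⟨i, hi⟩ : ∃ i, Sum.elim E F p = some i := by
      rcases p with x | y
      · exact Option.ne_none_iff_exists'.1 (h1 x)
      · exact Option.ne_none_iff_exists'.1 (h2 y)
    obtain ⟨x, hx⟩ := hE i
    obtain ⟨y, hy⟩ := hF i
    exact ⟨⟨x, Or.inr ⟨i, hi, hx⟩⟩, ⟨y, Or.inr ⟨i, hi, hy⟩⟩⟩

/-- A partition into points and generalised lines is determined by the relation between upper and
lower vertices. -/
theorem pointsOrGenLines_ext {α β : Setoid (X ⊕ X)} (hα : PointsOrGenLines α)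
    (hβ : PointsOrGenLines β) (h : ∀ x y, α (Sum.inl x) (Sum.inr y) ↔ β (Sum.inl x) (Sum.inr y)) :
    α = β := by
  have key : ∀ {α β : Setoid (X ⊕ X)}, PointsOrGenLines α →
      (∀ x y, α (Sum.inl x) (Sum.inr y) → β (Sum.inl x) (Sum.inr y)) →
      ∀ p q, α p q → β p q := by
    intro α β hα h p q hpq
    rw [pointsOrGenLines_iff] at hα
    rcases hα p with hp | ⟨⟨x, hx⟩, ⟨y, hy⟩⟩
    · rw [hp q hpq]
    have hqx := α.trans' (α.symm' hpq) hx
    have hqy := α.trans' (α.symm' hpq) hy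
    rcases p with p | p <;> rcases q with q | q
    · exact β.trans' (h _ _ hy) (β.symm' (h _ _ hqy))
    · exact h _ _ hpq
    · exact β.symm' (h _ _ (α.symm' hpq))
    · exact β.trans' (β.symm' (h _ _ (α.symm' hx))) (h _ _ (α.symm' hqx))
  ext p q
  exact ⟨key hα (fun x y => (h x y).1) p q, key hβ (fun x y => (h x y).2) p q⟩

theorem AllGenLines.pointsOrGenLines {α : Setoid (X ⊕ X)} (h : AllGenLines α) :
    PointsOrGenLines α := fun c hc => Or.inr (h c hc)

theorem lines_left_cancel {E F G : X → Option Y} (hE : IsFrame E) (h : lines E F = lines E G) :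
    F = G := by
  have key : ∀ {F G : X → Option Y}, lines E F = lines E G → ∀ y i, F y = some i → G y = some i := by
    intro F G h y i hi
    obtain ⟨x, hx⟩ := hE i
    have : lines E F (Sum.inl x) (Sum.inr y) := lines_inl_inr.2 ⟨i, hx, hi⟩
    rw [h] at this
    obtain ⟨j, hj, hj'⟩ := lines_inl_inr.1 this
    rw [hx] at hj
    cases hj
    exact hj'
  funext y
  exact Option.ext fun i => ⟨key h y i, key h.symm y i⟩

/-- The labelling of the vertices by a numbering of the generalised lines. -/
noncomputable def label {α : Setoid (X ⊕ X)} (N : Y ≃ ↥(genLines α)) (p : X ⊕ X) : Option Y :=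
  open Classical in if h : ∃ i, p ∈ (N i : Set (X ⊕ X)) then some h.choose else none

theorem label_eq_some {α : Setoid (X ⊕ X)} (N : Y ≃ ↥(genLines α)) {p : X ⊕ X} {i : Y} :
    label N p = some i ↔ p ∈ (N i : Set (X ⊕ X)) := by
  have uniq : ∀ {j k}, p ∈ (N j : Set (X ⊕ X)) → p ∈ (N k : Set (X ⊕ X)) → j = k := fun hj hk =>
    N.injective (Subtype.ext (classes_eq (N _).2.1 (N _).2.1 hj hk))
  unfold label
  split_ifs with h
  · rw [Option.some_inj]
    constructor
    · rintro rfl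
      exact h.choose_spec
    · exact uniq h.choose_spec
  · simp only [false_iff]
    exact fun hi => h ⟨i, hi⟩

theorem isFrame_label_inl {α : Setoid (X ⊕ X)} (N : Y ≃ ↥(genLines α)) :
    IsFrame fun x => label N (Sum.inl x) := by
  intro i
  obtain ⟨x, hx⟩ := (N i).2.2.1
  exact ⟨x, (label_eq_some N).2 hx⟩

theorem isFrame_label_inr {α : Setoid (X ⊕ X)} (N : Y ≃ ↥(genLines α)) :
    IsFrame fun x => label N (Sum.inr x) := by
  intro i
  obtain ⟨x, hx⟩ := (N i).2.2.2
  exact ⟨x, (label_eq_some N).2 hx⟩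

theorem lines_label {α : Setoid (X ⊕ X)} (hα : PointsOrGenLines α) (N : Y ≃ ↥(genLines α)) :
    lines (fun x => label N (Sum.inl x)) (fun x => label N (Sum.inr x)) = α := by
  refine pointsOrGenLines_ext
    (pointsOrGenLines_lines (isFrame_label_inl N) (isFrame_label_inr N)) hα ?_
  intro x y
  rw [lines_inl_inr]
  simp only [label_eq_some]
  constructor
  · rintro ⟨i, hx, hy⟩
    obtain ⟨c, hc⟩ := (N i).2.1
    rw [hc] at hx hy
    exact α.trans' hx (α.symm' hy)
  · intro h
    obtain ⟨i, hi⟩ := N.surjective ⟨{p | α p (Sum.inl x)}, Setoid.mem_classes α _,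
      ⟨x, α.refl' _⟩, ⟨y, α.symm' h⟩⟩
    refine ⟨i, ?_, ?_⟩ <;> rw [hi]
    · exact α.refl' _
    · exact α.symm' h

/-- The numbering of the generalised lines by the labels. -/
noncomputable def lineEquiv {E F : X → Option Y} (hE : IsFrame E) (hF : IsFrame F) :
    Y ≃ ↥(genLines (lines E F)) :=
  Equiv.ofBijective
    (fun i => ⟨{p | Sum.elim E F p = some i}, by
      obtain ⟨x, hx⟩ := hE i
      obtain ⟨y, hy⟩ := hF i
      refine ⟨⟨Sum.inl x, ?_⟩, ⟨x, hx⟩, ⟨y, hy⟩⟩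
      ext p
      constructor
      · intro hp
        exact Or.inr ⟨i, hp, hx⟩
      · rintro (rfl | ⟨j, hp, hj⟩)
        · exact hx
        · obtain rfl : i = j := Option.some.inj (hx.symm.trans hj)
          exact hp⟩)
    (by
      constructor
      · intro i j h
        obtain ⟨x, hx⟩ := hE i
        have h1 : {p | Sum.elim E F p = some i} = {p | Sum.elim E F p = some j} :=
          congrArg Subtype.val h
        exact Option.some.inj (hx.symm.trans ((Set.ext_iff.1 h1 (Sum.inl x)).1 hx))
      · rintro ⟨c, ⟨p, rfl⟩, ⟨x, hx⟩, ⟨y, hy⟩⟩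
        obtain ⟨i, hi, hi'⟩ := lines_inl_inr.1 ((lines E F).trans' hx ((lines E F).symm' hy))
        have hp : Sum.elim E F p = some i := by
          rcases hx with rfl | ⟨j, hj, hj'⟩
          · exact hi
          · rw [hj', ← hj]
            exact hi
        refine ⟨i, Subtype.ext ?_⟩
        ext q
        constructor
        · intro hq
          exact Or.inr ⟨i, hq, hp⟩
        · rintro (rfl | ⟨j, hq, hj⟩)
          · exact hp
          · change _ = _
            rw [hq, ← hj, hp])

theorem mem_lineEquiv {E F : X → Option Y} (hE : IsFrame E) (hF : IsFrame F) (i : Y) (p : X ⊕ X) :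
    p ∈ (lineEquiv hE hF i : Set (X ⊕ X)) ↔ Sum.elim E F p = some i := Iff.rfl

theorem rank_lines {E F : X → Option Y} (hE : IsFrame E) (hF : IsFrame F) :
    rank (lines E F) = Nat.card Y :=
  (Nat.card_congr (lineEquiv hE hF)).symm

/-- The labels are renamed. -/
def relabel (π : Equiv.Perm Y) (E : X → Option Y) : X → Option Y := fun x => (E x).map π

theorem relabel_eq_some {π : Equiv.Perm Y} {E : X → Option Y} {x : X} {i : Y} :
    relabel π E x = some i ↔ E x = some (π⁻¹ i) := by
  rw [relabel, Option.map_eq_some_iff]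
  constructor
  · rintro ⟨j, hj, rfl⟩
    simpa using hj
  · intro h
    exact ⟨_, h, by simp⟩

@[simp] theorem relabel_one (E : X → Option Y) : relabel 1 E = E := by
  funext x
  simp [relabel]

theorem relabel_relabel (π σ : Equiv.Perm Y) (E : X → Option Y) :
    relabel π (relabel σ E) = relabel (π * σ) E := by
  funext x
  simp [relabel, Function.comp_def]

theorem IsFrame.relabel {E : X → Option Y} (hE : IsFrame E) (π : Equiv.Perm Y) :
    IsFrame (relabel π E) := by
  intro i
  obtain ⟨x, hx⟩ := hE (π⁻¹ i)
  exact ⟨x, relabel_eq_some.2 hx⟩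

theorem relabel_left_cancel {E : X → Option Y} (hE : IsFrame E) {π σ : Equiv.Perm Y}
    (h : relabel π E = relabel σ E) : π = σ := by
  ext i
  obtain ⟨x, hx⟩ := hE i
  have := congrFun h x
  simpa [relabel, hx] using this

theorem lines_relabel (π : Equiv.Perm Y) (E F : X → Option Y) :
    lines (relabel π E) (relabel π F) = lines E F := by
  have key : ∀ p i, Sum.elim (relabel π E) (relabel π F) p = some i ↔
      Sum.elim E F p = some (π⁻¹ i) := by
    rintro (x | x) i <;> exact relabel_eq_some
  ext p q
  rw [lines_apply, lines_apply]
  simp only [key]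
  refine or_congr Iff.rfl ⟨fun ⟨i, h⟩ => ⟨_, h⟩, fun ⟨i, h⟩ => ⟨π i, by simpa using h⟩⟩

/-- Two pairs of frames of one partition are two numberings of the same set of generalised lines;
`π` is the change of numbering. -/
theorem exists_relabel {E F E' F' : X → Option Y} (hE : IsFrame E) (hF : IsFrame F)
    (hE' : IsFrame E') (hF' : IsFrame F') (h : lines E F = lines E' F') :
    ∃ π : Equiv.Perm Y, E' = relabel π E ∧ F' = relabel π F := by
  let N : Y ≃ ↥(genLines (lines E F)) :=
    (lineEquiv hE' hF').trans (Equiv.setCongr (congrArg genLines h.symm))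
  let π : Equiv.Perm Y := (lineEquiv hE hF).trans N.symm
  have key : ∀ p i, Sum.elim E' F' p = some i ↔ Sum.elim E F p = some (π⁻¹ i) := by
    intro p i
    rw [← mem_lineEquiv hE' hF', ← mem_lineEquiv hE hF]
    have : lineEquiv hE hF (π⁻¹ i) = N i := by
      change lineEquiv hE hF ((lineEquiv hE hF).symm (N i)) = N i
      rw [Equiv.apply_symm_apply]
    rw [this]
    rfl
  refine ⟨π, ?_, ?_⟩
  · funext x
    exact Option.ext fun i => (key (Sum.inl x) i).trans relabel_eq_some.symm
  · funext x
    exact Option.ext fun i => (key (Sum.inr x) i).trans relabel_eq_some.symm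

end Lines

/-! ### Inverse semigroups of partitions into points and generalised lines -/

open PartitionLike

section Brackets

variable {S X : Type*} [PartitionLike S X]

/-- The element `s` has the generalised lines given by the frames `E` and `F`. -/
structure Br {m : ℕ} (s : S) (E F : X → Option (Fin m)) : Prop where
  frame_left : IsFrame E
  frame_right : IsFrame F
  part_eq : part s = lines E F

variable {m : ℕ} {E F G E' F' : X → Option (Fin m)} {s t : S}

theorem Br.rk_eq (h : Br s E F) : rk s = m := by
  rw [rk, h.part_eq, rank_lines h.frame_left h.frame_right, Nat.card_fin]

theorem Br.relabel (h : Br s E F) (π : Equiv.Perm (Fin m)) :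
    Br s (relabel π E) (relabel π F) :=
  ⟨h.frame_left.relabel π, h.frame_right.relabel π, h.part_eq.trans (lines_relabel π E F).symm⟩

theorem Br.exists_relabel (h : Br s E F) (h' : Br s E' F') :
    ∃ π : Equiv.Perm (Fin m), E' = PartitionSemigroups.relabel π E ∧
      F' = PartitionSemigroups.relabel π F :=
  PartitionSemigroups.exists_relabel h.frame_left h.frame_right h'.frame_left h'.frame_right
    (h.part_eq.symm.trans h'.part_eq)

theorem Br.right_unique (h : Br s E F) (h' : Br s E G) : F = G :=
  lines_left_cancel h.frame_left (h.part_eq.symm.trans h'.part_eq)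

theorem Br.rk_le_card [Finite X] (h : Br s E F) : m ≤ Nat.card X := by
  choose f hf using h.frame_left
  have : Function.Injective f := fun i j hij => by
    have := hf i
    rw [hij, hf j] at this
    exact (Option.some.inj this).symm
  simpa using Nat.card_le_card_of_injective f this

end Brackets

/-- Inverse semigroups of partitions into points and generalised lines that contain all such
partitions, or all without points, and in which products with matching generalised lines are the
natural ones. -/
class FramedSemigroup (S : Type*) (X : outParam Type*) [InverseSemigroup S] [PartitionLike S X] where
  /-- there are no points -/
  total : Prop
  /-- the least rank -/
  minRank : ℕ
  minRank_le_one : minRank ≤ 1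
  nonempty : Nonempty S
  minRank_le : ∀ s : S, minRank ≤ rk s
  part_injective : Function.Injective (part : S → Setoid (X ⊕ X))
  exists_part_iff : ∀ α : Setoid (X ⊕ X),
    (∃ s : S, part s = α) ↔ PointsOrGenLines α ∧ (total → AllGenLines α)
  part_inv : ∀ s : S, part s⁻¹ = flip (part s)
  part_mul : ∀ {m : ℕ} {E F G : X → Option (Fin m)} {s t : S},
    IsFrame E → IsFrame F → IsFrame G → part s = lines E F → part t = lines F G →
      part (s * t) = lines E G
  exists_below : ∀ {m : ℕ} {E : X → Option (Fin (m + 1))} {e : S}, IsFrame E → minRank ≤ m →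
    part e = lines E E → ∃ f : S, IsIdempotentElem f ∧ e * f = f ∧ rk f = m
  -- Non-commutation means that conjugation by `x` moves `f`. The bound on `m` is needed: there is
  -- only one idempotent of rank `minRank`, and conjugation fixes it.
  exists_below_moved : ∀ {m : ℕ} {E : X → Option (Fin (m + 1))} {π : Equiv.Perm (Fin (m + 1))}
    {x : S}, IsFrame E → minRank + 1 ≤ m → π ≠ 1 → part x = lines E (relabel π E) →
    ∃ f : S, IsIdempotentElem f ∧ x * x⁻¹ * f = f ∧ rk f = m ∧ f * x ≠ x * f

variable {S X : Type*} [InverseSemigroup S] [PartitionLike S X]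

section Frames

variable {m : ℕ} {E F G E' F' : X → Option (Fin m)} {s t : S}

variable [FramedSemigroup S X]

theorem Br.ext (h : Br s E F) (h' : Br t E F) : s = t :=
  FramedSemigroup.part_injective (h.part_eq.trans h'.part_eq.symm)

theorem Br.inv (h : Br s E F) : Br s⁻¹ F E :=
  ⟨h.frame_right, h.frame_left, by rw [FramedSemigroup.part_inv, h.part_eq, flip_lines]⟩

theorem Br.mul (h : Br s E F) (h' : Br t F G) : Br (s * t) E G :=
  ⟨h.frame_left, h'.frame_right,
    FramedSemigroup.part_mul h.frame_left h.frame_right h'.frame_right h.part_eq h'.part_eq⟩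

theorem Br.mul_inv (h : Br s E F) : Br (s * s⁻¹) E E := h.mul h.inv

theorem Br.inv_mul (h : Br s E F) : Br (s⁻¹ * s) F F := h.inv.mul h

theorem Br.idem (h : Br s E E) : IsIdempotentElem s := (h.mul h).ext h

theorem Br.eq_of_idem (h : Br s E F) (hs : IsIdempotentElem s) : E = F := by
  have h' := h.mul_inv
  rw [idem_inv hs, hs.eq] at h'
  exact h'.right_unique h

/-- All pairs of frames that occur in the semigroup can be combined. -/
theorem Br.combine (h : Br s E F) (h' : Br t E' F') : ∃ u : S, Br u E E' := by
  obtain ⟨h1, h2⟩ := (FramedSemigroup.exists_part_iff _).1 ⟨s, h.part_eq⟩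
  obtain ⟨h3, h4⟩ := (FramedSemigroup.exists_part_iff _).1 ⟨t, h'.part_eq⟩
  obtain ⟨u, hu⟩ := (FramedSemigroup.exists_part_iff (S := S) (lines E E')).2
    ⟨pointsOrGenLines_lines h.frame_left h'.frame_left, fun ht =>
      (allGenLines_lines_iff h.frame_left h'.frame_left).2
        ⟨((allGenLines_lines_iff h.frame_left h.frame_right).1 (h2 ht)).1,
          ((allGenLines_lines_iff h'.frame_left h'.frame_right).1 (h4 ht)).1⟩⟩
  exact ⟨u, h.frame_left, h'.frame_left, hu⟩

theorem Br.greenH {x y : S} {π : Equiv.Perm (Fin m)}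
    (hx : Br x E F) (hy : Br y E (PartitionSemigroups.relabel π F)) : GreenH x y :=
  greenH_iff.2 ⟨hx.mul_inv.ext hy.mul_inv, (hx.inv_mul.relabel π).ext hy.inv_mul⟩

variable [Finite X]

theorem exists_br (s : S) (hm : rk s = m) : ∃ E F : X → Option (Fin m), Br s E F := by
  have e : Fin m ≃ ↥(genLines (part s)) := by
    have : Nat.card ↥(genLines (part s)) = m := hm
    exact (Finite.equivFinOfCardEq this).symm
  have hp := ((FramedSemigroup.exists_part_iff (S := S) (part s)).1 ⟨s, rfl⟩).1
  exact ⟨_, _, isFrame_label_inl e, isFrame_label_inr e, (lines_label hp e).symm⟩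

theorem exists_br_idem {e : S} (he : IsIdempotentElem e) (hm : rk e = m) :
    ∃ E : X → Option (Fin m), Br e E E := by
  obtain ⟨E, F, h⟩ := exists_br e hm
  obtain rfl := h.eq_of_idem he
  exact ⟨E, h⟩

end Frames

/-! ### The rank -/

section Rank

variable [FramedSemigroup S X] [Finite X]

theorem rk_le_card (s : S) : rk s ≤ Nat.card X := by
  obtain ⟨E, F, h⟩ := exists_br s rfl
  exact h.rk_le_card

theorem rk_inv (s : S) : rk s⁻¹ = rk s := by
  obtain ⟨E, F, h⟩ := exists_br s rfl
  exact h.inv.rk_eq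

theorem rk_mul_inv (s : S) : rk (s * s⁻¹) = rk s := by
  obtain ⟨E, F, h⟩ := exists_br s rfl
  exact h.mul_inv.rk_eq

theorem rk_inv_mul (s : S) : rk (s⁻¹ * s) = rk s := by
  obtain ⟨E, F, h⟩ := exists_br s rfl
  exact h.inv_mul.rk_eq

theorem finite_of_framed (S : Type*) {X : Type*} [InverseSemigroup S] [PartitionLike S X]
    [FramedSemigroup S X] [Finite X] : Finite S := by
  have : Finite (Setoid (X ⊕ X)) :=
    Finite.of_injective (fun α : Setoid (X ⊕ X) => α.r) fun α β h => Setoid.ext fun a b =>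
      iff_of_eq (congrFun (congrFun h a) b)
  exact Finite.of_injective _ (FramedSemigroup.part_injective (S := S))

theorem exists_conj {e f : S} (he : IsIdempotentElem e) (hf : IsIdempotentElem f)
    (h : rk e = rk f) : ∃ x : S, x * x⁻¹ = e ∧ x⁻¹ * x = f := by
  obtain ⟨E, hE⟩ := exists_br_idem he rfl
  obtain ⟨F, hF⟩ := exists_br_idem hf h.symm
  obtain ⟨x, hx⟩ := hE.combine hF
  exact ⟨x, hx.mul_inv.ext hE, hx.inv_mul.ext hF⟩

/-- A counting argument: `eS ⊆ fS`, and for `x` with `x * x⁻¹ = e` and `x⁻¹ * x = f`, left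
multiplication by `x` embeds `fS` in `eS`. As `S` is finite, `eS = fS`, so `f` is fixed by `e`. -/
theorem eq_of_le_of_rk_eq {e f : S} (he : IsIdempotentElem e) (hf : IsIdempotentElem f)
    (hle : e * f = e) (h : rk e = rk f) : e = f := by
  have := finite_of_framed S
  obtain ⟨x, hx, hx'⟩ := exists_conj he hf h
  have hsub : {y : S | e * y = y} ⊆ {y : S | f * y = y} := by
    intro y (hy : e * y = y)
    change f * y = y
    rw [← hy, ← mul_assoc, idem_comm hf he, hle]
  have hcard : {y : S | f * y = y}.ncard ≤ {y : S | e * y = y}.ncard := by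
    refine Set.ncard_le_ncard_of_injOn (fun y => x * y) ?_ ?_ (Set.toFinite _)
    · intro y _
      change e * (x * y) = x * y
      rw [← hx, mul_assoc, mul_inv_mul_assoc]
    · intro y (hy : f * y = y) z (hz : f * z = z) (hyz : x * y = x * z)
      rw [← hy, ← hz, ← hx', mul_assoc, hyz, ← mul_assoc]
  have heq := Set.eq_of_subset_of_ncard_le hsub hcard (Set.toFinite _)
  have : f ∈ {y : S | e * y = y} := by
    rw [heq]
    exact hf.eq
  exact hle.symm.trans this

theorem exists_le_of_rk {e : S} (he : IsIdempotentElem e) {l : ℕ}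
    (hl : FramedSemigroup.minRank S ≤ l) (hle : l ≤ rk e) :
    ∃ f : S, IsIdempotentElem f ∧ e * f = f ∧ rk f = l := by
  obtain ⟨d, hd⟩ := Nat.exists_eq_add_of_le hle
  induction d generalizing e with
  | zero => exact ⟨e, he, he.eq, hd⟩
  | succ d ih =>
    obtain ⟨E, hE⟩ := exists_br_idem he hd
    obtain ⟨f, hf, hef, hfr⟩ :=
      FramedSemigroup.exists_below hE.frame_left (hl.trans (Nat.le_add_right _ _)) hE.part_eq
    obtain ⟨g, hg, hfg, hgr⟩ := ih hf (hfr ▸ Nat.le_add_right l d) hfr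
    refine ⟨g, hg, ?_, hgr⟩
    rw [← hfg, ← mul_assoc, hef]

/-- Were `rk f < rk e`, some `g ≤ e ≤ f` would have the rank of `f`. Then `g = f`, and `e` would
equal `f`. -/
theorem rk_le_of_le {e f : S} (he : IsIdempotentElem e) (hf : IsIdempotentElem f)
    (hle : e * f = e) : rk e ≤ rk f := by
  by_contra hlt
  push Not at hlt
  obtain ⟨g, hg, heg, hgr⟩ := exists_le_of_rk he (FramedSemigroup.minRank_le f) hlt.le
  have hgf : g * f = g := by
    rw [← heg, mul_assoc, idem_comm hg hf, ← mul_assoc, hle]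
  obtain rfl := eq_of_le_of_rk_eq hg hf hgf hgr
  rw [hle] at heg
  rw [heg] at hlt
  exact lt_irrefl _ hlt

theorem rk_mul_le_left (x y : S) : rk (x * y) ≤ rk x := by
  rw [← rk_mul_inv (x * y), ← rk_mul_inv x]
  refine rk_le_of_le (idem_mul_inv _) (idem_mul_inv _) ?_
  rw [idem_comm (idem_mul_inv _) (idem_mul_inv _), ← mul_assoc, ← mul_assoc,
    InverseSemigroup.mul_inv_mul]

theorem rk_mul_le_right (x y : S) : rk (x * y) ≤ rk y := by
  rw [← rk_inv (x * y), ← rk_inv y, inv_mul_rev]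
  exact rk_mul_le_left _ _

theorem rk_conj {x e : S} (hle : x * x⁻¹ * e = e) (he : IsIdempotentElem e) :
    rk (x⁻¹ * e * x) = rk e := by
  refine le_antisymm ((rk_mul_le_left _ _).trans (rk_mul_le_right _ _)) ?_
  have h : x * (x⁻¹ * e * x) * x⁻¹ = e := by
    calc x * (x⁻¹ * e * x) * x⁻¹ = x * x⁻¹ * (e * (x * x⁻¹)) := by simp only [mul_assoc]
      _ = e := by rw [idem_comm he (idem_mul_inv x), hle, hle]
  calc rk e = rk (x * (x⁻¹ * e * x) * x⁻¹) := by rw [h]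
    _ ≤ _ := (rk_mul_le_left _ _).trans (rk_mul_le_right _ _)

/-- The idempotent `(s * x)⁻¹ * (s * x)` lies below `x⁻¹ * x`. Without loss of rank they coincide,
so the lower frame `F` survives. -/
theorem Br.exists_mul_left {m : ℕ} {E F : X → Option (Fin m)} {x : S} (h : Br x E F) (s : S)
    (hs : rk (s * x) = m) : ∃ G, Br (s * x) G F := by
  obtain ⟨G, F', h'⟩ := exists_br (s * x) hs
  have hle : (s * x)⁻¹ * (s * x) * (x⁻¹ * x) = (s * x)⁻¹ * (s * x) := by
    rw [mul_assoc, mul_assoc, mul_inv_mul]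
  have heq := eq_of_le_of_rk_eq (idem_inv_mul _) (idem_inv_mul _) hle
    (by rw [rk_inv_mul, rk_inv_mul, hs, h.rk_eq])
  have h1 := h'.inv_mul
  rw [heq] at h1
  obtain ⟨π, rfl, -⟩ := h1.exists_relabel h.inv_mul
  exact ⟨_, h'.relabel π⟩

theorem Br.exists_mul_right {m : ℕ} {E F : X → Option (Fin m)} {x : S} (h : Br x E F) (s : S)
    (hs : rk (x * s) = m) : ∃ G, Br (x * s) E G := by
  rw [← rk_inv, inv_mul_rev] at hs
  obtain ⟨G, hG⟩ := h.inv.exists_mul_left s⁻¹ hs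
  rw [← inv_mul_rev] at hG
  exact ⟨G, by simpa using hG.inv⟩

end Rank

section Perms

variable {S X : Type*} [InverseSemigroup S] [PartitionLike S X] [FramedSemigroup S X]

/-! ### The group of a normal subsemigroup -/

/-- The permutations `π` for which all elements with generalised lines `E_i ∪ E_{π⁻¹ i}'` belong
to `K`. -/
def permsOf {K : Subsemigroup S} (hK : IsNormalSubsemigroup K) (m : ℕ) :
    Subgroup (Equiv.Perm (Fin m)) :=
  let M : Submonoid (Equiv.Perm (Fin m)) :=
    { carrier := {π | ∀ (E : X → Option (Fin m)) (x : S), Br x E (relabel π E) → x ∈ K}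
      one_mem' := by
        intro E x h
        rw [relabel_one] at h
        exact hK.1 x h.idem
      mul_mem' := by
        intro π σ hπ hσ E x h
        -- Factor `[E; πσE] = [E; πE][πE; πσE]`; the second factor is `[E; σE]` renumbered by `π`.
        obtain ⟨y, hy⟩ := h.combine (h.mul_inv.relabel π)
        obtain ⟨w, hw⟩ := h.combine (h.mul_inv.relabel σ)
        have hw' := hw.relabel π
        rw [relabel_relabel] at hw'
        rw [h.ext (hy.mul hw')]
        exact K.mul_mem (hπ E y hy) (hσ E w hw) }
  { M with
    inv_mem' := by
      intro π hπ
      -- In a finite group the inverse is a power, so a submonoid is a subgroup.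
      obtain ⟨j, hj⟩ := (isOfFinOrder_of_finite π).mem_powers_iff_mem_zpowers.2
        (inv_mem (Subgroup.mem_zpowers π))
      rw [← hj]
      exact M.pow_mem hπ j }

theorem mem_permsOf {K : Subsemigroup S} {hK : IsNormalSubsemigroup K} {m : ℕ}
    {π : Equiv.Perm (Fin m)} : π ∈ permsOf hK m ↔
      ∀ (E : X → Option (Fin m)) (x : S), Br x E (relabel π E) → x ∈ K := Iff.rfl

/-- Renumbering by `g⁻¹` turns `[E; gπg⁻¹E]` into `[D; πD]` with `D = g⁻¹E`, and membership in
`permsOf` quantifies over all frames. -/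
theorem normal_permsOf {K : Subsemigroup S} (hK : IsNormalSubsemigroup K) (m : ℕ) :
    (permsOf hK m).Normal := by
  refine ⟨fun π hπ g E x h => mem_permsOf.1 hπ (relabel g⁻¹ E) x ?_⟩
  have := h.relabel g⁻¹
  rwa [relabel_relabel, ← mul_assoc, ← mul_assoc, inv_mul_cancel, one_mul,
    ← relabel_relabel] at this

/-- One witness suffices: with `s = [E; F]`, conjugation gives `s⁻¹xs = [F; E][E; πE][πE; πF] = [F;
πF]`. -/
theorem Br.mem_permsOf {K : Subsemigroup S} (hK : IsNormalSubsemigroup K) {m : ℕ} {x : S}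
    {E : X → Option (Fin m)} {π : Equiv.Perm (Fin m)}
    (h : Br x E (PartitionSemigroups.relabel π E)) (hx : x ∈ K) : π ∈ permsOf hK m := by
  intro F y hy
  obtain ⟨s, hs⟩ := h.combine hy
  rw [hy.ext ((hs.inv.mul h).mul (hs.relabel π))]
  exact hK.2 s x hx

theorem Br.mul_inv_eq_inv_mul {m : ℕ} {E : X → Option (Fin m)} {x : S} {π : Equiv.Perm (Fin m)}
    (h : Br x E (PartitionSemigroups.relabel π E)) : x * x⁻¹ = x⁻¹ * x :=
  (h.mul_inv.relabel π).ext h.inv_mul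

end Perms

section Classify

variable {S X : Type*} [InverseSemigroup S] [PartitionLike S X] [FramedSemigroup S X] [Finite X]

/-! ### Normal congruences on the idempotents -/

/-- The product lies below both factors and cannot have smaller rank, so it equals each of them. -/
theorem eq_of_rk_minRank {e f : S} (he : IsIdempotentElem e) (hf : IsIdempotentElem f)
    (her : rk e ≤ FramedSemigroup.minRank S) (hfr : rk f ≤ FramedSemigroup.minRank S) : e = f := by
  have key : ∀ {e f : S}, IsIdempotentElem e → IsIdempotentElem f →
      rk e ≤ FramedSemigroup.minRank S → e * f = e := by
    intro e f he hf her
    refine eq_of_le_of_rk_eq (idem_mul he hf) he ?_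
      (le_antisymm (rk_mul_le_left _ _) (her.trans (FramedSemigroup.minRank_le _)))
    rw [idem_comm (idem_mul he hf) he, ← mul_assoc, he.eq]
  rw [← key he hf her, idem_comm he hf, key hf he hfr]

/-- Multiply the pair by an idempotent `f ≤ e` of the rank of `g` and conjugate `f` to `g`. The
other side becomes an idempotent of minimal rank, which can only be `z`. -/
theorem IsNormalCongruence.rel_of_rk_le {Λ : S → S → Prop} (hΛ : IsNormalCongruence Λ) {e z g : S}
    (hz : rk z ≤ FramedSemigroup.minRank S) (h : Λ e z) (hg : IsIdempotentElem g)
    (hle : rk g ≤ rk e) : Λ g z := by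
  obtain ⟨he, hzi⟩ := hΛ.idem _ _ h
  obtain ⟨f, hf, hef, hfr⟩ := exists_le_of_rk he (FramedSemigroup.minRank_le g) hle
  have h1 : Λ f (z * f) := by
    have := hΛ.mul _ _ _ _ h (hΛ.refl f hf)
    rwa [hef] at this
  obtain ⟨x, hx, hx'⟩ := exists_conj hf hg hfr
  have h2 := hΛ.conj x _ _ h1
  have h3 : x⁻¹ * f * x = g := by rw [← hx, mul_assoc, mul_assoc, mul_inv_mul, hx']
  have h4 : x⁻¹ * (z * f) * x = z :=
    eq_of_rk_minRank (idem_conj (idem_mul hzi hf) x) hzi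
      ((rk_mul_le_left _ _).trans ((rk_mul_le_right _ _).trans ((rk_mul_le_left _ _).trans hz))) hz
  rwa [h3, h4] at h2

/-- For each idempotent `f` there is an element of the next lower rank below `e` that differs
from `f`. -/
theorem exists_below_ne {m : ℕ} {e : S} (he : IsIdempotentElem e) (hm : rk e = m + 1)
    (hr : FramedSemigroup.minRank S + 1 ≤ m) (f : S) :
    ∃ g : S, IsIdempotentElem g ∧ e * g = g ∧ rk g = m ∧ g ≠ f := by
  obtain ⟨E, hE⟩ := exists_br_idem he hm
  have hm1 : 1 ≤ m := by omega
  let π : Equiv.Perm (Fin (m + 1)) := Equiv.swap 0 (Fin.last m)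
  have hπ : π ≠ 1 := by
    intro h
    have := Equiv.swap_eq_one_iff.1 h
    have := congrArg Fin.val this
    simp at this
    omega
  obtain ⟨x, hx⟩ := hE.combine (hE.relabel π)
  obtain ⟨g, hg, hle, hgr, hne⟩ :=
    FramedSemigroup.exists_below_moved hE.frame_left hr hπ hx.part_eq
  have hxe : x * x⁻¹ = e := hx.mul_inv.ext hE
  have hxe' : x⁻¹ * x = e := hx.inv_mul.ext (hE.relabel π)
  -- Both `g` and its conjugate by `x` are candidates; they differ, so one of them is not `f`.
  by_cases hgf : g = f
  · refine ⟨x⁻¹ * g * x, idem_conj hg x, ?_, ?_, ?_⟩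
    · simp only [← hxe', mul_assoc, inv_mul_inv_assoc]
    · rw [rk_conj hle hg, hgr]
    · rintro rfl
      apply hne
      rw [idem_mul_eq hg x, ← hgf]
  · exact ⟨g, hg, by rw [← hxe, hle], hgr, hgf⟩

/-- Descent on the rank of `e`. For `g < e` of rank one less with `g ≠ f`, multiplication by `g`
gives a pair `g`, `g * f` of the same kind. By induction `g` is related to the bottom, hence so is
`f`, whose rank is at most that of `g`, and so is `e`. -/
theorem IsNormalCongruence.exists_rel_minRank {Λ : S → S → Prop} (hΛ : IsNormalCongruence Λ)
    {m : ℕ} {e f : S} (hm : rk e = m) (h : Λ e f) (hle : e * f = f) (hne : f ≠ e) :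
    ∃ z, rk z ≤ FramedSemigroup.minRank S ∧ Λ e z := by
  induction m generalizing e f with
  | zero =>
    obtain ⟨he, hf⟩ := hΛ.idem _ _ h
    have hfr : rk f ≤ 0 := by
      rw [← hle, ← hm]
      exact rk_mul_le_left _ _
    exact ⟨f, hfr.trans (Nat.zero_le _), h⟩
  | succ m ih =>
    obtain ⟨he, hf⟩ := hΛ.idem _ _ h
    have hfe : f * e = f := by rw [idem_comm hf he, hle]
    have hfr : rk f ≤ m := by
      have h1 : rk f ≤ m + 1 := by
        rw [← hm]
        exact rk_le_of_le hf he hfe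
      by_contra h2
      exact hne (eq_of_le_of_rk_eq hf he hfe (by omega))
    by_cases hr : FramedSemigroup.minRank S + 1 ≤ m
    · obtain ⟨g, hg, heg, hgr, hgf⟩ := exists_below_ne he hm hr f
      have hgf' : g * f ≠ g := by
        intro h1
        have h2 := rk_le_of_le hg hf h1
        exact hgf (eq_of_le_of_rk_eq hg hf h1 (by omega))
      have h1 : Λ g (g * f) := by
        have := hΛ.mul _ _ _ _ (hΛ.refl g hg) h
        rwa [idem_comm hg he, heg] at this
      obtain ⟨z, hz, hgz⟩ := ih hgr h1 (by rw [← mul_assoc, hg.eq]) hgf'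
      exact ⟨z, hz, hΛ.trans _ _ _ h (hΛ.rel_of_rk_le hz hgz hf (by omega))⟩
    · exact ⟨f, by omega, h⟩

theorem exists_idem_minRank (S : Type*) {X : Type*} [InverseSemigroup S] [PartitionLike S X]
    [FramedSemigroup S X] [Finite X] : ∃ z : S, IsIdempotentElem z ∧ rk z = FramedSemigroup.minRank S := by
  obtain ⟨s⟩ := FramedSemigroup.nonempty (S := S)
  obtain ⟨z, hz, -, hzr⟩ := exists_le_of_rk (idem_mul_inv s) le_rfl (FramedSemigroup.minRank_le _)
  exact ⟨z, hz, hzr⟩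

/-- Each normal congruence on the idempotents collapses the idempotents up to some rank. -/
theorem IsNormalCongruence.eq_relLambda {Λ : S → S → Prop} (hΛ : IsNormalCongruence Λ) :
    ∃ k, FramedSemigroup.minRank S ≤ k ∧ k ≤ Nat.card X ∧ Λ = relLambda S k := by
  have := finite_of_framed S
  obtain ⟨z, hz, hzr⟩ := exists_idem_minRank S
  have : Nonempty {e // Λ e z} := ⟨z, hΛ.refl z hz⟩
  -- The number `k` is the largest rank in the class of the minimal idempotent `z`.
  obtain ⟨⟨e₀, he₀⟩, hmax⟩ := Finite.exists_max fun e : {e // Λ e z} => rk e.1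
  refine ⟨rk e₀, FramedSemigroup.minRank_le _, rk_le_card _, ?_⟩
  have key : ∀ e f, Λ e f → e * f ≠ e → Λ e z := by
    intro e f h hne
    obtain ⟨he, hf⟩ := hΛ.idem _ _ h
    have h1 : Λ e (e * f) := by
      have := hΛ.mul _ _ _ _ (hΛ.refl e he) h
      rwa [he.eq] at this
    obtain ⟨z', hz', hez'⟩ := hΛ.exists_rel_minRank rfl h1 (by rw [← mul_assoc, he.eq]) hne
    rwa [eq_of_rk_minRank (hΛ.idem _ _ hez').2 hz hz' hzr.le] at hez'
  have hle : ∀ e, Λ e z → e ∈ rankIdempotents S (rk e₀) := fun e he =>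
    ⟨(hΛ.idem _ _ he).1, hmax ⟨e, he⟩⟩
  funext e f
  apply propext
  constructor
  · intro h
    obtain ⟨he, hf⟩ := hΛ.idem _ _ h
    by_cases hef : e = f
    · exact Or.inl ⟨he, hef⟩
    right
    -- Distinct `e` and `f` cannot lie below each other, so `key` applies to at least one of them.
    by_cases h1 : e * f = e
    · have h2 : f * e ≠ f := by
        rw [idem_comm hf he, h1]
        exact hef
      have h3 := key f e (hΛ.symm _ _ h) h2
      exact ⟨hle e (hΛ.trans _ _ _ h h3), hle f h3⟩
    · have h3 := key e f h h1
      exact ⟨hle e h3, hle f (hΛ.trans _ _ _ (hΛ.symm _ _ h) h3)⟩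
  · rintro (⟨he, rfl⟩ | ⟨⟨he, her⟩, hf, hfr⟩)
    · exact hΛ.refl e he
    · exact hΛ.trans _ _ _ (hΛ.rel_of_rk_le hzr.le he₀ he her)
        (hΛ.symm _ _ (hΛ.rel_of_rk_le hzr.le he₀ hf hfr))

/-! ### The copies of normal subgroups -/

theorem Br.exists_of_greenH {m : ℕ} {E F : X → Option (Fin m)} {x y : S} (hx : Br x E F)
    (h : GreenH x y) : ∃ π : Equiv.Perm (Fin m), Br y E (PartitionSemigroups.relabel π F) := by
  obtain ⟨h1, h2⟩ := greenH_iff.1 h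
  obtain ⟨E', F', hy⟩ := exists_br y (by rw [← rk_mul_inv, ← h1, rk_mul_inv, hx.rk_eq])
  have h3 := hy.mul_inv
  rw [← h1] at h3
  obtain ⟨σ, rfl, -⟩ := h3.exists_relabel hx.mul_inv
  have hy := hy.relabel σ
  have h4 := hy.inv_mul
  rw [← h2] at h4
  obtain ⟨τ, hτ, -⟩ := hx.inv_mul.exists_relabel h4
  exact ⟨τ, hτ ▸ hy⟩

/-- In `groupCopy` the line starting at `E i` ends at `E (π i)`, while in `[E; σE]` it ends at `E
(σ⁻¹ i)`. So `π` and `σ` are mutually inverse, which is harmless for a subgroup. -/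
theorem mem_normalPart_iff {m : ℕ} {A : Subgroup (Equiv.Perm (Fin m))} {x : S} :
    x ∈ normalPart S A ↔
      ∃ E : X → Option (Fin m), ∃ π ∈ A, Br x E (relabel π E) := by
  constructor
  · rintro ⟨e, he, hm, hxe, N, π, hπ, hN⟩
    have hp := ((FramedSemigroup.exists_part_iff (S := S) (PartitionLike.part e)).1 ⟨e, rfl⟩).1
    obtain ⟨D, hD⟩ : ∃ D : X → Option (Fin m), D = fun x => label N (Sum.inl x) := ⟨_, rfl⟩
    have hb : Br e D _ :=
      ⟨hD ▸ isFrame_label_inl N, isFrame_label_inr N, hD ▸ (lines_label hp N).symm⟩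
    have heq := hb.eq_of_idem he
    rw [← heq] at hb
    obtain ⟨τ, hx⟩ := hb.exists_of_greenH hxe.symm
    have hτ : τ⁻¹ = π := by
      ext i
      obtain ⟨a, ha⟩ := hx.frame_left i
      obtain ⟨b, hb'⟩ := hx.frame_left (π i)
      have h5 := hN i a b ((label_eq_some N).1 ((congrFun hD a).symm.trans ha))
        ((label_eq_some N).1 ((congrFun heq b).symm.trans hb'))
      rw [hx.part_eq, lines_inl_inr] at h5
      obtain ⟨j, hj, hj'⟩ := h5
      obtain rfl := Option.some.inj (ha.symm.trans hj)
      rw [relabel_eq_some, hb'] at hj'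
      rw [Option.some.inj hj']
    exact ⟨D, τ, by simpa [← hτ] using hπ, hx⟩
  · rintro ⟨E, π, hπ, h⟩
    have he := h.mul_inv
    refine ⟨x * x⁻¹, idem_mul_inv x, he.rk_eq, (he.greenH h).symm,
      (lineEquiv h.frame_left h.frame_left).trans
        (Equiv.setCongr (congrArg genLines he.part_eq.symm)), π⁻¹, inv_mem hπ, ?_⟩
    intro i a b ha hb
    rw [h.part_eq, lines_inl_inr]
    exact ⟨i, ha, relabel_eq_some.2 hb⟩

theorem Br.mem_of_mem_normalPart {m : ℕ} {A : Subgroup (Equiv.Perm (Fin m))} (hA : A.Normal)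
    {x : S} {E : X → Option (Fin m)} {π : Equiv.Perm (Fin m)}
    (h : Br x E (PartitionSemigroups.relabel π E)) (hx : x ∈ normalPart S A) : π ∈ A := by
  obtain ⟨D, σ, hσ, h'⟩ := mem_normalPart_iff.1 hx
  obtain ⟨τ, rfl, hτ⟩ := h'.exists_relabel h
  rw [relabel_relabel, relabel_relabel] at hτ
  have := relabel_left_cancel h'.frame_left hτ
  rw [eq_mul_inv_of_mul_eq this]
  exact hA.conj_mem _ hσ _

/-- For `x = [E; F]` and `y = [E; πF]` one has `x * y⁻¹ = [E; π⁻¹E]`. The right-hand side no longer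
involves the product of `S`, which is what the comparison of `PIStar` and `PIBar` uses. -/
theorem relF_iff {k : ℕ} {A : Subgroup (Equiv.Perm (Fin (k + 1)))} (hA : A.Normal) {x y : S} :
    relF S A x y ↔ ∃ E F : X → Option (Fin (k + 1)), ∃ π ∈ A, Br x E F ∧ Br y E (relabel π F) := by
  have key : ∀ {E F : X → Option (Fin (k + 1))} {π : Equiv.Perm (Fin (k + 1))}, Br x E F →
      Br y E (relabel π F) → Br (x * y⁻¹) E (relabel π⁻¹ E) := by
    intro E F π hx hy
    have := hy.inv.relabel π⁻¹
    rw [relabel_relabel, inv_mul_cancel, relabel_one] at this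
    exact hx.mul this
  constructor
  · rintro ⟨hx, hy, hxy, hn⟩
    obtain ⟨E, F, hx⟩ := exists_br x hx
    obtain ⟨π, hy⟩ := hx.exists_of_greenH hxy
    exact ⟨E, F, π, by simpa using (key hx hy).mem_of_mem_normalPart hA hn, hx, hy⟩
  · rintro ⟨E, F, π, hπ, hx, hy⟩
    exact ⟨hx.rk_eq, hy.rk_eq, hx.greenH hy,
      mem_normalPart_iff.2 ⟨E, π⁻¹, inv_mem hπ, key hx hy⟩⟩

/-! ### Congruence pairs -/

/-- Above rank `k` the relation `Λ` is equality, so axiom (ii) puts every `a ∈ K` of such rank in a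
group; from rank `k + 2` on, a nontrivial group element would violate (ii) after multiplication by a
suitable idempotent. Axiom (i) yields `I_k ⊆ K`. -/
theorem IsCongruencePair.eq_kernelSet {K : Subsemigroup S} {Λ : S → S → Prop}
    (h : IsCongruencePair K Λ) {k : ℕ} (hk : FramedSemigroup.minRank S ≤ k)
    (hΛ : Λ = relLambda S k) :
    ∃ A : Subgroup (Equiv.Perm (Fin (k + 1))), A.Normal ∧ (K : Set S) = kernelSet S A := by
  have hK := h.normalSubsemigroup
  have hr : ∀ e f, Λ e f → k < rk e → e = f := by
    intro e f hef hlt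
    rw [hΛ] at hef
    rcases hef with ⟨-, hef⟩ | ⟨hef, -⟩
    · exact hef
    · exact absurd hef.2 (not_le.2 hlt)
  refine ⟨permsOf hK (k + 1), normal_permsOf hK _, Set.Subset.antisymm ?_ ?_⟩
  · intro a (ha : a ∈ K)
    by_cases hak : rk a ≤ k
    · exact Or.inr hak
    push Not at hak
    left
    have h1 : a * a⁻¹ = a⁻¹ * a := hr _ _ (h.mul_inv_rel a ha) (by rwa [rk_mul_inv])
    obtain ⟨m, hm⟩ : ∃ m, rk a = m + 1 := ⟨rk a - 1, by omega⟩
    obtain ⟨E, F, hE⟩ := exists_br a hm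
    have h2 := hE.inv_mul
    rw [← h1] at h2
    obtain ⟨π, rfl, -⟩ := hE.mul_inv.exists_relabel h2
    by_cases hmk : m = k
    · subst hmk
      exact Or.inr (mem_normalPart_iff.2 ⟨E, π, hE.mem_permsOf hK ha, hE⟩)
    · left
      by_cases hπ : π = 1
      · rw [hπ, relabel_one] at hE
        exact hE.idem
      · exfalso
        -- Here the rank `m` of `f` is still above `k`. Since `f * a ∈ K`, axiom (ii) gives `f =
        -- a⁻¹fa`, against the choice of `f`.
        obtain ⟨f, hf, hle, hfr, hne⟩ :=
          FramedSemigroup.exists_below_moved hE.frame_left (by omega) hπ hE.part_eq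
        have h3 : rk f ≤ rk (f * a) := by
          calc rk f = rk (f * a * a⁻¹) := by rw [mul_assoc, idem_comm hf (idem_mul_inv a), hle]
            _ ≤ _ := rk_mul_le_left _ _
        have h4 := hr _ _ (h.mul_inv_rel (f * a) (K.mul_mem (hK.1 f hf) ha))
          (by rw [rk_mul_inv]; omega)
        have h5 : f * a * (f * a)⁻¹ = f := by
          rw [inv_mul_rev, idem_inv hf, mul_assoc, ← mul_assoc a, hle, hf.eq]
        have h6 : (f * a)⁻¹ * (f * a) = a⁻¹ * f * a := by
          rw [inv_mul_rev, idem_inv hf, mul_assoc, ← mul_assoc f, hf.eq, ← mul_assoc]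
        rw [h5, h6] at h4
        apply hne
        rw [idem_mul_eq hf a, ← h4]
  · rintro a ((ha | ha) | ha)
    · exact hK.1 a ha
    · obtain ⟨E, π, hπ, hE⟩ := mem_normalPart_iff.1 ha
      exact mem_permsOf.1 hπ E a hE
    · obtain ⟨z, hz, hzr⟩ := exists_idem_minRank S
      have hr : rk (a * z) = FramedSemigroup.minRank S :=
        le_antisymm ((rk_mul_le_right _ _).trans hzr.le) (FramedSemigroup.minRank_le _)
      -- In minimal rank the two idempotents of `a * z` agree, so `a * z` lies in a group; this
      -- group is trivial because `minRank ≤ 1`.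
      have haz : IsIdempotentElem (a * z) := by
        obtain ⟨E, F, hE⟩ := exists_br (a * z) hr
        have h1 : a * z * (a * z)⁻¹ = (a * z)⁻¹ * (a * z) :=
          eq_of_rk_minRank (idem_mul_inv _) (idem_inv_mul _) hE.mul_inv.rk_eq.le
            hE.inv_mul.rk_eq.le
        have h2 := hE.mul_inv
        rw [h1] at h2
        obtain ⟨π, rfl, -⟩ := hE.inv_mul.exists_relabel h2
        have : Subsingleton (Fin (FramedSemigroup.minRank S)) :=
          Fin.subsingleton_iff_le_one.2 (FramedSemigroup.minRank_le_one (S := S))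
        rw [Subsingleton.elim π 1, relabel_one] at hE
        exact hE.idem
      -- Axiom (i) with `e = z`: both `z` and `a⁻¹ * a` have rank at most `k`, hence are related.
      refine h.mem_of_mul_mem a z hz (hK.1 _ haz) ?_
      rw [hΛ]
      exact Or.inr ⟨⟨hz, hzr.le.trans hk⟩, idem_inv_mul a, (rk_inv_mul a).le.trans ha⟩

theorem isCongruencePair_of_eq {K : Subsemigroup S} {Λ : S → S → Prop}
    (hK : IsNormalSubsemigroup K) (hΛ : IsNormalCongruence Λ) {k : ℕ} (hk : Λ = relLambda S k)
    {A : Subgroup (Equiv.Perm (Fin (k + 1)))} (hKA : (K : Set S) = kernelSet S A) :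
    IsCongruencePair K Λ where
  normalSubsemigroup := hK
  normalCongruence := hΛ
  mem_of_mul_mem := by
    intro a e he hae h
    rw [hk] at h
    rcases h with ⟨-, rfl⟩ | ⟨-, -, h⟩
    · rwa [mul_inv_mul] at hae
    · rw [← SetLike.mem_coe, hKA]
      exact Or.inr ((rk_inv_mul a).symm.le.trans h)
  mul_inv_rel := by
    intro a ha
    rw [← SetLike.mem_coe, hKA] at ha
    rw [hk]
    rcases ha with (ha | ha) | ha
    · have ha : IsIdempotentElem a := ha
      rw [idem_inv ha]
      exact Or.inl ⟨idem_mul ha ha, rfl⟩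
    · obtain ⟨E, π, hπ, hE⟩ := mem_normalPart_iff.1 ha
      exact Or.inl ⟨idem_mul_inv a, hE.mul_inv_eq_inv_mul⟩
    · exact Or.inr ⟨⟨idem_mul_inv a, (rk_mul_inv a).le.trans ha⟩,
        idem_inv_mul a, (rk_inv_mul a).le.trans ha⟩

/-- Classification of the congruence pairs. -/
theorem isCongruencePair_iff {K : Subsemigroup S} {Λ : S → S → Prop}
    (hK : IsNormalSubsemigroup K) (hΛ : IsNormalCongruence Λ) :
    IsCongruencePair K Λ ↔ ∃ k, FramedSemigroup.minRank S ≤ k ∧ k ≤ Nat.card X ∧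
      Λ = relLambda S k ∧ ∃ A : Subgroup (Equiv.Perm (Fin (k + 1))), A.Normal ∧
        (K : Set S) = kernelSet S A := by
  constructor
  · intro h
    obtain ⟨k, hk, hkn, hk'⟩ := hΛ.eq_relLambda
    exact ⟨k, hk, hkn, hk', h.eq_kernelSet hk hk'⟩
  · rintro ⟨k, -, -, hk, A, -, hA⟩
    exact isCongruencePair_of_eq hK hΛ hk hA

/-! ### Congruences -/

/-- If `x⁻¹ * x = y⁻¹ * y`, then `x * y⁻¹` has left idempotent `x * x⁻¹` and right idempotent `y *
y⁻¹`. So the three ranks agree, and the parts of `kernelSet` match the parts of `relRho`; an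
idempotent `x * y⁻¹` forces `x = y`. -/
theorem relRho_iff_pair {k : ℕ} {A : Subgroup (Equiv.Perm (Fin (k + 1)))} {x y : S} :
    relRho S A x y ↔ relLambda S k (x⁻¹ * x) (y⁻¹ * y) ∧ x * y⁻¹ ∈ kernelSet S A := by
  constructor
  · rintro (rfl | ⟨hx, hy, hxy, hn⟩ | ⟨hx, hy⟩)
    · exact ⟨Or.inl ⟨idem_inv_mul x, rfl⟩, Or.inl (Or.inl (idem_mul_inv x))⟩
    · exact ⟨Or.inl ⟨idem_inv_mul x, (greenH_iff.1 hxy).2⟩, Or.inl (Or.inr hn)⟩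
    · exact ⟨Or.inr ⟨⟨idem_inv_mul x, (rk_inv_mul x).le.trans hx⟩, idem_inv_mul y,
        (rk_inv_mul y).le.trans hy⟩, Or.inr ((rk_mul_le_left _ _).trans hx)⟩
  · rintro ⟨h1 | ⟨⟨-, hx⟩, -, hy⟩, h2⟩
    · have hx : x * y⁻¹ * (x * y⁻¹)⁻¹ = x * x⁻¹ := by
        rw [inv_mul_rev, inv_inv, mul_assoc, ← mul_assoc y⁻¹, ← h1.2, ← mul_assoc x, mul_inv_mul]
      have hy : (x * y⁻¹)⁻¹ * (x * y⁻¹) = y * y⁻¹ := by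
        rw [inv_mul_rev, inv_inv, mul_assoc, ← mul_assoc x⁻¹, h1.2, ← mul_assoc y, mul_inv_mul]
      have hrx : rk (x * y⁻¹) = rk x := by rw [← rk_mul_inv, hx, rk_mul_inv]
      have hry : rk (x * y⁻¹) = rk y := by rw [← rk_inv_mul, hy, rk_mul_inv]
      rcases h2 with (h2 | h2) | h2
      · left
        have h2 : IsIdempotentElem (x * y⁻¹) := h2
        rw [idem_inv h2, h2.eq] at hx hy
        calc x = x * y⁻¹ * y := by rw [mul_assoc, ← h1.2, mul_inv_mul]
          _ = y := by rw [hy, mul_assoc, mul_inv_mul]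
      · obtain ⟨E, π, hπ, hE⟩ := mem_normalPart_iff.1 h2
        refine Or.inr (Or.inl ⟨hrx ▸ hE.rk_eq, hry ▸ hE.rk_eq, greenH_iff.2 ⟨?_, h1.2⟩, h2⟩)
        rw [← hx, ← hy]
        exact hE.mul_inv_eq_inv_mul
      · exact Or.inr (Or.inr ⟨hrx.symm.le.trans h2, hry.symm.le.trans h2⟩)
    · exact Or.inr (Or.inr ⟨(rk_inv_mul x).symm.le.trans hx, (rk_inv_mul y).symm.le.trans hy⟩)

theorem relRho_symm {k : ℕ} {A : Subgroup (Equiv.Perm (Fin (k + 1)))} (hA : A.Normal) {x y : S}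
    (h : relRho S A x y) : relRho S A y x := by
  rcases h with rfl | h | ⟨hx, hy⟩
  · exact Or.inl rfl
  · obtain ⟨E, F, π, hπ, hx, hy⟩ := (relF_iff hA).1 h
    exact Or.inr (Or.inl ((relF_iff hA).2 ⟨E, relabel π F, π⁻¹, inv_mem hπ, hy,
      by simpa [relabel_relabel] using hx⟩))
  · exact Or.inr (Or.inr ⟨hy, hx⟩)

theorem relRho_trans {k : ℕ} {A : Subgroup (Equiv.Perm (Fin (k + 1)))} (hA : A.Normal) {x y z : S}
    (h : relRho S A x y) (h' : relRho S A y z) : relRho S A x z := by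
  have hlt : ∀ {x : S}, rk x = k + 1 → x ∈ rankIdeal S k → False := by
    intro x h1 (h2 : rk x ≤ k)
    omega
  rcases h with rfl | h | ⟨hx, hy⟩
  · exact h'
  · rcases h' with rfl | h' | ⟨hy, -⟩
    · exact Or.inr (Or.inl h)
    · obtain ⟨E, F, π, hπ, hx, hy⟩ := (relF_iff hA).1 h
      obtain ⟨E', F', σ, hσ, hy', hz⟩ := (relF_iff hA).1 h'
      obtain ⟨τ, rfl, rfl⟩ := hy.exists_relabel hy'
      have hz := hz.relabel τ⁻¹
      simp only [relabel_relabel, inv_mul_cancel, relabel_one] at hz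
      refine Or.inr (Or.inl ((relF_iff hA).2 ⟨E, F, _, ?_, hx, hz⟩))
      -- The two steps use numberings that differ by `τ`; the composite permutation is `τ⁻¹στπ`, in
      -- `A` by normality.
      have := A.mul_mem (hA.conj_mem σ hσ τ⁻¹) hπ
      simpa [mul_assoc] using this
    · exact (hlt h.2.1 hy).elim
  · rcases h' with rfl | h' | ⟨-, hz⟩
    · exact Or.inr (Or.inr ⟨hx, hy⟩)
    · exact (hlt h'.1 hy).elim
    · exact Or.inr (Or.inr ⟨hx, hz⟩)

/-- With `y = x * h` for the group element `h = [F; πF]`, one gets `s * y = (s * x) * h`. Either `s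
* x` keeps its rank and its lower frame `F`, or both products fall into `I_k`. -/
theorem relRho_mul_left {k : ℕ} {A : Subgroup (Equiv.Perm (Fin (k + 1)))} (hA : A.Normal) {x y : S}
    (h : relRho S A x y) (s : S) : relRho S A (s * x) (s * y) := by
  rcases h with rfl | h | ⟨hx, hy⟩
  · exact Or.inl rfl
  · obtain ⟨E, F, π, hπ, hx, hy⟩ := (relF_iff hA).1 h
    obtain ⟨h, hh⟩ := hx.inv_mul.combine (hx.inv_mul.relabel π)
    have hyx : y = x * h := hy.ext (hx.mul hh)
    have hle : rk (s * x) ≤ k + 1 := (rk_mul_le_right _ _).trans hx.rk_eq.le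
    by_cases hr : rk (s * x) = k + 1
    · obtain ⟨G, hG⟩ := hx.exists_mul_left s hr
      refine Or.inr (Or.inl ((relF_iff hA).2 ⟨G, F, π, hπ, hG, ?_⟩))
      rw [hyx, ← mul_assoc]
      exact hG.mul hh
    · have hr' : rk (s * x) ≤ k := by omega
      refine Or.inr (Or.inr ⟨hr', ?_⟩)
      rw [hyx, ← mul_assoc]
      exact (rk_mul_le_left _ _).trans hr'
  · exact Or.inr (Or.inr ⟨(rk_mul_le_right _ _).trans hx, (rk_mul_le_right _ _).trans hy⟩)

theorem relRho_mul_right {k : ℕ} {A : Subgroup (Equiv.Perm (Fin (k + 1)))} (hA : A.Normal)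
    {x y : S} (h : relRho S A x y) (s : S) : relRho S A (x * s) (y * s) := by
  rcases h with rfl | h | ⟨hx, hy⟩
  · exact Or.inl rfl
  · obtain ⟨E, F, π, hπ, hx, hy⟩ := (relF_iff hA).1 h
    obtain ⟨h, hh⟩ := hx.mul_inv.combine (hx.mul_inv.relabel π)
    have hyx : y = h * x := hy.ext (hh.mul (hx.relabel π))
    have hle : rk (x * s) ≤ k + 1 := (rk_mul_le_left _ _).trans hx.rk_eq.le
    by_cases hr : rk (x * s) = k + 1
    · obtain ⟨G, hG⟩ := hx.exists_mul_right s hr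
      refine Or.inr (Or.inl ((relF_iff hA).2 ⟨E, G, π, hπ, hG, ?_⟩))
      rw [hyx, mul_assoc]
      exact hh.mul (hG.relabel π)
    · have hr' : rk (x * s) ≤ k := by omega
      refine Or.inr (Or.inr ⟨hr', ?_⟩)
      rw [hyx, mul_assoc]
      exact (rk_mul_le_right _ _).trans hr'
  · exact Or.inr (Or.inr ⟨(rk_mul_le_left _ _).trans hx, (rk_mul_le_left _ _).trans hy⟩)

theorem isCongruence_relRho {k : ℕ} {A : Subgroup (Equiv.Perm (Fin (k + 1)))} (hA : A.Normal) :
    IsCongruence (relRho S A) :=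
  ⟨{ r := relRho S A
     iseqv := ⟨fun _ => Or.inl rfl, relRho_symm hA, relRho_trans hA⟩
     mul' := fun h h' => relRho_trans hA (relRho_mul_right hA h _) (relRho_mul_left hA h' _) },
    fun _ _ => Iff.rfl⟩

/-- Classification of the congruences. -/
theorem isCongruence_iff {ρ : S → S → Prop} :
    IsCongruence ρ ↔ ∃ k, FramedSemigroup.minRank S ≤ k ∧ k ≤ Nat.card X ∧
      ∃ A : Subgroup (Equiv.Perm (Fin (k + 1))), A.Normal ∧ ρ = relRho S A := by
  constructor
  · rintro ⟨c, hc⟩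
    have h := conKernel_conTrace_pair c
    obtain ⟨k, hk, hkn, hΛ, A, hA, hK⟩ :=
      (isCongruencePair_iff h.normalSubsemigroup h.normalCongruence).1 h
    refine ⟨k, hk, hkn, A, hA, ?_⟩
    funext x y
    apply propext
    rw [← hc, con_iff_kernel_trace, hΛ, relRho_iff_pair, ← hK, SetLike.mem_coe]
  · rintro ⟨k, -, -, A, hA, rfl⟩
    exact isCongruence_relRho hA

end Classify

/-! ### The three semigroups are inverse semigroups -/

section Saturated

variable {X : Type*}

/-- The union of `U` and `V'` is a union of blocks of `α`. -/
def Saturated (α : Setoid (X ⊕ X)) (U V : Set X) : Prop :=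
  ∀ p q, α p q → (Sum.elim (· ∈ U) (· ∈ V) p ↔ Sum.elim (· ∈ U) (· ∈ V) q)

/-- This turns the natural product into composition of relations on the power set, which gives
associativity and the inverse laws without tracing paths through several layers. -/
theorem saturated_natMul {α β : Setoid (X ⊕ X)} {U W : Set X} :
    Saturated (natMul α β) U W ↔ ∃ V, Saturated α U V ∧ Saturated β V W := by
  constructor
  · intro h
    let P : X ⊕ (X ⊕ X) → Prop := fun v => ∃ p, Sum.elim (· ∈ U) (· ∈ W) p ∧
      Relation.EqvGen (Stack α β) (Sum.map id Sum.inr p) v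
    have hP : ∀ {v w}, Stack α β v w → (P v ↔ P w) := fun hvw =>
      ⟨fun ⟨p, hp, hv⟩ => ⟨p, hp, hv.trans _ _ _ (.rel _ _ hvw)⟩,
        fun ⟨p, hp, hv⟩ => ⟨p, hp, hv.trans _ _ _ (.symm _ _ (.rel _ _ hvw))⟩⟩
    have hout : ∀ p, P (Sum.map id Sum.inr p) ↔ Sum.elim (· ∈ U) (· ∈ W) p := fun p =>
      ⟨fun ⟨q, hq, hqp⟩ => (h q p hqp).1 hq, fun hp => ⟨p, hp, .refl _⟩⟩
    -- The middle set consists of the vertices connected to a vertex of `U` or `W`.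
    refine ⟨{y | P (Sum.inr (Sum.inl y))}, ?_, ?_⟩
    · have hu : ∀ p, Sum.elim (· ∈ U) (· ∈ {y | P (Sum.inr (Sum.inl y))}) p ↔
          P (Sum.map id Sum.inl p) := by
        rintro (x | y)
        · exact (hout (Sum.inl x)).symm
        · exact Iff.rfl
      intro p q hpq
      rw [hu, hu]
      exact hP (.upper p q hpq)
    · have hu : ∀ p, Sum.elim (· ∈ {y | P (Sum.inr (Sum.inl y))}) (· ∈ W) p ↔
          P (Sum.inr p) := by
        rintro (x | y)
        · exact Iff.rfl
        · exact (hout (Sum.inr y)).symm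
      intro p q hpq
      rw [hu, hu]
      exact hP (.lower p q hpq)
  · rintro ⟨V, hα, hβ⟩
    let P : X ⊕ (X ⊕ X) → Prop := Sum.elim (· ∈ U) (Sum.elim (· ∈ V) (· ∈ W))
    have hP : ∀ v w, Relation.EqvGen (Stack α β) v w → (P v ↔ P w) := by
      intro v w h
      induction h with
      | rel v w h =>
        cases h with
        | upper p q h =>
          have := hα p q h
          rcases p with p | p <;> rcases q with q | q <;> exact this
        | lower p q h => exact hβ p q h
      | refl => exact Iff.rfl
      | symm _ _ _ ih => exact ih.symm
      | trans _ _ _ _ _ ih ih' => exact ih.trans ih'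
    intro p q h
    have := hP _ _ h
    rcases p with p | p <;> rcases q with q | q <;> exact this

theorem saturated_flip {α : Setoid (X ⊕ X)} {U V : Set X} :
    Saturated (flip α) U V ↔ Saturated α V U := by
  have key : ∀ {α : Setoid (X ⊕ X)} {U V : Set X}, Saturated α V U → Saturated (flip α) U V := by
    intro α U V h p q hpq
    have := h _ _ hpq
    rcases p with p | p <;> rcases q with q | q <;> exact this
  refine ⟨fun h => ?_, key⟩
  intro p q hpq
  exact key h p q (by rw [flip_apply, flip_apply, Sum.swap_swap, Sum.swap_swap]; exact hpq)

/-- The block of `p` in `β` is itself saturated, so it is a union of blocks of `α`, and conversely.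
-/
theorem saturated_ext {α β : Setoid (X ⊕ X)} (h : ∀ U V, Saturated α U V ↔ Saturated β U V) :
    α = β := by
  have key : ∀ {α β : Setoid (X ⊕ X)}, (∀ U V, Saturated β U V → Saturated α U V) →
      ∀ p q, α p q → β p q := by
    intro α β h p q hpq
    have hu : ∀ r, Sum.elim (· ∈ {x | β p (Sum.inl x)}) (· ∈ {y | β p (Sum.inr y)}) r ↔ β p r := by
      rintro (r | r) <;> exact Iff.rfl
    have := h {x | β p (Sum.inl x)} {y | β p (Sum.inr y)} (by
      intro r s hrs
      rw [hu, hu]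
      exact ⟨fun k => β.trans' k hrs, fun k => β.trans' k (β.symm' hrs)⟩) p q hpq
    rw [hu, hu] at this
    exact this.1 (β.refl' p)
  ext p q
  exact ⟨key (fun U V => (h U V).2) p q, key (fun U V => (h U V).1) p q⟩

/-- Every lower vertex is joined to an upper one, whose membership in `U` decides. -/
theorem Saturated.unique {α : Setoid (X ⊕ X)} (hα : AllGenLines α) {U V W : Set X}
    (h : Saturated α U V) (h' : Saturated α U W) : V = W := by
  rw [allGenLines_iff] at hα
  ext y
  obtain ⟨x, hx⟩ := (hα (Sum.inr y)).1
  exact (h _ _ hx).trans (h' _ _ hx).symm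

theorem isPoint_flip {α : Setoid (X ⊕ X)} {p : X ⊕ X} : IsPoint (flip α) p ↔ IsPoint α p.swap := by
  constructor
  · intro h q hq
    rw [← h q.swap (by rwa [flip_apply, Sum.swap_swap]), Sum.swap_swap]
  · intro h q hq
    rw [← Sum.swap_swap q, h q.swap hq, Sum.swap_swap]

theorem emb_swap (p : X ⊕ X) : emb p.swap = (emb p).swap := by
  rcases p with p | p <;> rfl

theorem bar_flip (α : Setoid (X ⊕ X)) : bar (flip α) = flip (bar α) := by
  have he : ∀ P, Extra (flip α) P ↔ Extra α P.swap := by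
    intro P
    rcases P with (_ | x) | (_ | x)
    · exact iff_of_true (Or.inl rfl) (Or.inr (Or.inl rfl))
    · exact (extra_emb (p := Sum.inl x)).trans (isPoint_flip.trans (extra_emb (p := Sum.inr x)).symm)
    · exact iff_of_true (Or.inr (Or.inl rfl)) (Or.inl rfl)
    · exact (extra_emb (p := Sum.inr x)).trans (isPoint_flip.trans (extra_emb (p := Sum.inl x)).symm)
  ext P Q
  change (Extra _ P ∧ Extra _ Q) ∨ (∃ p q, P = emb p ∧ Q = emb q ∧ α p.swap q.swap) ↔
    (Extra _ P.swap ∧ Extra _ Q.swap) ∨ ∃ p q, P.swap = emb p ∧ Q.swap = emb q ∧ α p q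
  rw [he, he]
  refine or_congr Iff.rfl ⟨?_, ?_⟩
  · rintro ⟨p, q, rfl, rfl, h⟩
    exact ⟨p.swap, q.swap, (emb_swap p).symm, (emb_swap q).symm, h⟩
  · rintro ⟨p, q, hp, hq, h⟩
    refine ⟨p.swap, q.swap, ?_, ?_, by rwa [Sum.swap_swap, Sum.swap_swap]⟩
    · rw [emb_swap, ← hp, Sum.swap_swap]
    · rw [emb_swap, ← hq, Sum.swap_swap]

theorem bar_starMul {α β : Setoid (X ⊕ X)} (hα : PointsOrGenLines α) (hβ : PointsOrGenLines β) :
    bar (starMul α β) = natMul (bar α) (bar β) :=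
  bar_unbar (allGenLines_natMul (allGenLines_bar hα) (allGenLines_bar hβ)) (natMul_bar_none α β)

/-- `U` and `V` are the upper and the lower part of a generalised line of `α`. -/
def LineParts (α : Setoid (X ⊕ X)) (U V : Set X) : Prop :=
  ∃ A ∈ genLines α, U = Sum.inl ⁻¹' A ∧ V = Sum.inr ⁻¹' A

theorem mem_join_inl {A B : Set (X ⊕ X)} {x : X} : Sum.inl x ∈ join A B ↔ Sum.inl x ∈ A := by
  simp [join]

theorem mem_join_inr {A B : Set (X ⊕ X)} {x : X} : Sum.inr x ∈ join A B ↔ Sum.inr x ∈ B := by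
  simp [join]

theorem mem_genLines_circMul {α β : Setoid (X ⊕ X)} {C : Set (X ⊕ X)} :
    C ∈ genLines (circMul α β) ↔
      ∃ A ∈ genLines α, ∃ B ∈ genLines β, Fits A B ∧ C = join A B := by
  have mem : ∀ A ∈ genLines α, ∀ B ∈ genLines β, Fits A B → join A B ∈ genLines (circMul α β) := by
    intro A hA B hB h
    obtain ⟨x, hx⟩ := hA.2.1
    obtain ⟨y, hy⟩ := hB.2.2
    have hx' : Sum.inl x ∈ join A B := mem_join_inl.2 hx
    have hy' : Sum.inr y ∈ join A B := mem_join_inr.2 hy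
    refine ⟨⟨Sum.inl x, ?_⟩, ⟨x, hx'⟩, ⟨y, hy'⟩⟩
    ext p
    constructor
    · intro hp
      exact Or.inr ⟨A, hA, B, hB, h, hp, hx'⟩
    · rintro (rfl | ⟨A', hA', B', hB', h', hp, hx''⟩)
      · exact hx'
      · obtain rfl := classes_eq hA'.1 hA.1 (mem_join_inl.1 hx'') hx
        obtain ⟨m, hm⟩ := hB.2.1
        obtain rfl := classes_eq hB'.1 hB.1 ((h' m).1 ((h m).2 hm)) hm
        exact hp
  constructor
  · intro hC
    obtain ⟨hc, ⟨x, hx⟩, ⟨y, hy⟩⟩ := hC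
    obtain ⟨c, rfl⟩ := hc
    obtain ⟨A, hA, B, hB, hxA, -, h⟩ := (circMul_inl_inr α β x y).1
      ((circMul α β).trans' hx ((circMul α β).symm' hy))
    exact ⟨A, hA, B, hB, h, classes_eq (Setoid.mem_classes _ _) (mem A hA B hB h).1 hx
      (mem_join_inl.2 hxA)⟩
  · rintro ⟨A, hA, B, hB, h, rfl⟩
    exact mem A hA B hB h

theorem lineParts_circMul {α β : Setoid (X ⊕ X)} {U W : Set X} :
    LineParts (circMul α β) U W ↔ ∃ V, LineParts α U V ∧ LineParts β V W := by
  have h1 : ∀ A B : Set (X ⊕ X), Sum.inl ⁻¹' join A B = Sum.inl ⁻¹' A := fun A B =>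
    Set.ext fun _ => mem_join_inl
  have h2 : ∀ A B : Set (X ⊕ X), Sum.inr ⁻¹' join A B = Sum.inr ⁻¹' B := fun A B =>
    Set.ext fun _ => mem_join_inr
  constructor
  · rintro ⟨C, hC, rfl, rfl⟩
    obtain ⟨A, hA, B, hB, h, rfl⟩ := mem_genLines_circMul.1 hC
    exact ⟨Sum.inr ⁻¹' A, ⟨A, hA, h1 A B, rfl⟩, B, hB, Set.ext h, h2 A B⟩
  · rintro ⟨V, ⟨A, hA, rfl, rfl⟩, B, hB, h, rfl⟩
    exact ⟨join A B, mem_genLines_circMul.2 ⟨A, hA, B, hB, Set.ext_iff.1 h, rfl⟩,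
      (h1 A B).symm, (h2 A B).symm⟩

theorem swap_mem_genLines_flip {α : Setoid (X ⊕ X)} {A : Set (X ⊕ X)} (hA : A ∈ genLines α) :
    Sum.swap ⁻¹' A ∈ genLines (flip α) := by
  obtain ⟨⟨c, rfl⟩, ⟨x, hx⟩, ⟨y, hy⟩⟩ := hA
  refine ⟨⟨c.swap, ?_⟩, ⟨y, hy⟩, ⟨x, hx⟩⟩
  ext p
  change α p.swap c ↔ α p.swap c.swap.swap
  rw [Sum.swap_swap]

theorem flip_flip (α : Setoid (X ⊕ X)) : flip (flip α) = α := by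
  ext p q
  rw [flip_apply, flip_apply, Sum.swap_swap, Sum.swap_swap]

theorem lineParts_flip {α : Setoid (X ⊕ X)} {U V : Set X} :
    LineParts (flip α) U V ↔ LineParts α V U := by
  have key : ∀ {α : Setoid (X ⊕ X)} {U V : Set X}, LineParts α V U → LineParts (flip α) U V := by
    rintro α U V ⟨A, hA, rfl, rfl⟩
    exact ⟨_, swap_mem_genLines_flip hA, rfl, rfl⟩
  exact ⟨fun h => by simpa [flip_flip] using key h, key⟩

theorem LineParts.unique {α : Setoid (X ⊕ X)} {U V W : Set X} (h : LineParts α U V)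
    (h' : LineParts α U W) : V = W := by
  obtain ⟨A, hA, rfl, rfl⟩ := h
  obtain ⟨B, hB, h, rfl⟩ := h'
  obtain ⟨x, hx⟩ := hA.2.1
  rw [classes_eq hA.1 hB.1 hx ((Set.ext_iff.1 h x).1 hx)]

theorem lineParts_ext {α β : Setoid (X ⊕ X)} (hα : PointsOrGenLines α) (hβ : PointsOrGenLines β)
    (h : ∀ U V, LineParts α U V ↔ LineParts β U V) : α = β := by
  have key : ∀ {α : Setoid (X ⊕ X)} (x y : X),
      α (Sum.inl x) (Sum.inr y) ↔ ∃ U V, LineParts α U V ∧ x ∈ U ∧ y ∈ V := by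
    intro α x y
    constructor
    · intro hxy
      exact ⟨_, _, ⟨{p | α p (Sum.inl x)}, ⟨Setoid.mem_classes _ _, ⟨x, α.refl' _⟩,
        ⟨y, α.symm' hxy⟩⟩, rfl, rfl⟩, α.refl' _, α.symm' hxy⟩
    · rintro ⟨_, _, ⟨A, ⟨⟨c, rfl⟩, -⟩, rfl, rfl⟩, hx, hy⟩
      exact α.trans' hx (α.symm' hy)
  refine pointsOrGenLines_ext hα hβ fun x y => ?_
  rw [key, key]
  simp only [h]

end Saturated

instance (X : Type*) : InverseSemigroup (IStar X) :=
  .ofRelations (fun a => Saturated a.1)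
    (fun _ _ h => Subtype.ext (saturated_ext h))
    (fun _ _ _ _ => saturated_natMul)
    (fun _ _ _ => saturated_flip)
    (fun a _ _ _ => Saturated.unique a.2)

/-- The relation is pulled back along `bar`, which is injective, has image in the partitions without
points, and respects products and converses. -/
instance (X : Type*) : InverseSemigroup (PIStar X) :=
  .ofRelations (fun a => Saturated (bar a.1))
    (fun a b h => Subtype.ext (by rw [← unbar_bar a.1, saturated_ext h, unbar_bar]))
    (fun a b U W => by
      rw [← saturated_natMul, ← bar_starMul a.2 b.2]
      rfl)
    (fun a U V => by
      change Saturated (bar (flip a.1)) U V ↔ _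
      rw [bar_flip]
      exact saturated_flip)
    (fun a _ _ _ => Saturated.unique (allGenLines_bar a.2))

/-- The product `∘` is composition of the partial bijections that send the upper part of a line to
its lower part. -/
instance (X : Type*) : InverseSemigroup (PIBar X) :=
  .ofRelations (fun a => LineParts a.1)
    (fun a b h => Subtype.ext (lineParts_ext a.2 b.2 h))
    (fun _ _ _ _ => lineParts_circMul)
    (fun _ _ _ => lineParts_flip)
    (fun _ _ _ _ => LineParts.unique)

/-! ### Products of partitions with matching generalised lines -/

section Products

variable {X Y Z : Type*}

/-- The labels are identified or dropped as `q` says. -/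
def bindLabel (q : Y → Option Z) (E : X → Option Y) : X → Option Z := fun x => (E x).bind q

theorem bindLabel_some (E : X → Option Y) : bindLabel some E = E := by
  funext x
  simp [bindLabel]

theorem bindLabel_eq_some {q : Y → Option Z} {E : X → Option Y} {x : X} {c : Z} :
    bindLabel q E x = some c ↔ ∃ i, E x = some i ∧ q i = some c := Option.bind_eq_some_iff

theorem IsFrame.bindLabel {q : Y → Option Z} {E : X → Option Y} (hE : IsFrame E)
    (hq : IsFrame q) : IsFrame (bindLabel q E) := by
  intro c
  obtain ⟨i, hi⟩ := hq c
  obtain ⟨x, hx⟩ := hE i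
  exact ⟨x, bindLabel_eq_some.2 ⟨i, hx, hi⟩⟩

theorem isFrame_some : IsFrame (some : Y → Option Y) := fun i => ⟨i, rfl⟩

theorem bindLabel_ne_none {q : Y → Option Z} {E : X → Option Y} (hE : ∀ x, E x ≠ none)
    (hq : ∀ i, q i ≠ none) (x : X) : bindLabel q E x ≠ none := by
  obtain ⟨i, hi⟩ := Option.ne_none_iff_exists'.1 (hE x)
  rw [bindLabel, hi]
  exact hq i

/-- Labels under `f` are constant along connections, since the lower partition is finer than its
image under `f`. Conversely, each bottom vertex is joined to a middle vertex with the same label, so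
connections reduce to the upper partition. -/
theorem natMul_ker {f : Y → Z} {E F G : X → Y} (h : ∀ z, ∃ y, F y = G z) :
    natMul (Setoid.ker (Sum.elim (f ∘ E) (f ∘ F))) (Setoid.ker (Sum.elim F G)) =
      Setoid.ker (Sum.elim (f ∘ E) (f ∘ G)) := by
  let φ : X ⊕ (X ⊕ X) → Z := Sum.elim (f ∘ E) (Sum.elim (f ∘ F) (f ∘ G))
  have hφ : ∀ v w, Relation.EqvGen (Stack (Setoid.ker (Sum.elim (f ∘ E) (f ∘ F)))
      (Setoid.ker (Sum.elim F G))) v w → φ v = φ w := by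
    intro v w h
    induction h with
    | rel v w h =>
      cases h with
      | upper p q h =>
        rcases p with p | p <;> rcases q with q | q <;> exact h
      | lower p q h =>
        rcases p with p | p <;> rcases q with q | q <;> exact congrArg f h
    | refl => rfl
    | symm _ _ _ ih => exact ih.symm
    | trans _ _ _ _ _ ih ih' => exact ih.trans ih'
  have hlow : ∀ z, ∃ y, f (F y) = f (G z) ∧ Relation.EqvGen (Stack (Setoid.ker
      (Sum.elim (f ∘ E) (f ∘ F))) (Setoid.ker (Sum.elim F G)))
      (Sum.inr (Sum.inl y)) (Sum.inr (Sum.inr z)) := by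
    intro z
    obtain ⟨y, hy⟩ := h z
    exact ⟨y, congrArg f hy, .rel _ _ (.lower (Sum.inl y) (Sum.inr z) hy)⟩
  ext p r
  constructor
  · intro h
    have := hφ _ _ h
    rcases p with p | p <;> rcases r with r | r <;> exact this
  · intro hpr
    rcases p with x | z <;> rcases r with x' | z'
    · exact .rel _ _ (.upper (Sum.inl x) (Sum.inl x') hpr)
    · obtain ⟨y, hy, h1⟩ := hlow z'
      exact .trans _ _ _ (.rel _ _ (.upper (Sum.inl x) (Sum.inr y) (hpr.trans hy.symm))) h1
    · obtain ⟨y, hy, h1⟩ := hlow z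
      exact .trans _ _ _ (.symm _ _ h1)
        (.rel _ _ (.upper (Sum.inr y) (Sum.inl x') (hy.trans hpr)))
    · obtain ⟨y, hy, h1⟩ := hlow z
      obtain ⟨y', hy', h2⟩ := hlow z'
      exact .trans _ _ _ (.trans _ _ _ (.symm _ _ h1)
        (.rel _ _ (.upper (Sum.inr y) (Sum.inr y') (hy.trans (hpr.trans hy'.symm))))) h2

theorem lines_eq_ker {E F : X → Option Y} (hE : ∀ x, E x ≠ none) (hF : ∀ x, F x ≠ none) :
    lines E F = Setoid.ker (Sum.elim E F) := by
  ext p q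
  rw [lines_apply, Setoid.ker_def]
  constructor
  · rintro (rfl | ⟨i, h, h'⟩)
    · rfl
    · rw [h, h']
  · intro h
    have hp : Sum.elim E F p ≠ none := by
      rcases p with p | p
      · exact hE p
      · exact hF p
    obtain ⟨i, hi⟩ := Option.ne_none_iff_exists'.1 hp
    exact Or.inr ⟨i, hi, h ▸ hi⟩

theorem natMul_lines {q : Y → Option Z} {E F G : X → Option Y} (hE : ∀ x, E x ≠ none)
    (hF : ∀ x, F x ≠ none) (hG : ∀ x, G x ≠ none) (hq : ∀ i, q i ≠ none) (hF' : IsFrame F) :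
    natMul (lines (bindLabel q E) (bindLabel q F)) (lines F G) =
      lines (bindLabel q E) (bindLabel q G) := by
  rw [lines_eq_ker (bindLabel_ne_none hE hq) (bindLabel_ne_none hF hq), lines_eq_ker hF hG,
    lines_eq_ker (bindLabel_ne_none hE hq) (bindLabel_ne_none hG hq)]
  refine natMul_ker (f := fun i : Option Y => i.bind q) fun z => ?_
  obtain ⟨i, hi⟩ := Option.ne_none_iff_exists'.1 (hG z)
  rw [hi]
  exact hF' i

/-- The labelling of `X ∪ {x̄}` without a label for `x̄`. -/
def extend (E : X → Option Y) : Option X → Option Y := fun P => P.bind E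

/-- The value `none` acts as the label of the extra block. Dropping a line in `PIStar` thus becomes
merging it with that block, and `natMul_ker` covers both operations. -/
theorem bar_lines {E F : X → Option Y} (hE : IsFrame E) (hF : IsFrame F) :
    bar (lines E F) = Setoid.ker (Sum.elim (extend E) (extend F)) := by
  have hemb : ∀ p, Sum.elim (extend E) (extend F) (emb p) = Sum.elim E F p := by
    rintro (p | p) <;> rfl
  have hpt : ∀ p, IsPoint (lines E F) p ↔ Sum.elim E F p = none := by
    intro p
    constructor
    · intro hp
      rcases hi : Sum.elim E F p with _ | i
      · rfl
      · obtain ⟨x, hx⟩ := hE i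
        obtain ⟨y, hy⟩ := hF i
        have h1 := hp (Sum.inl x) (Or.inr ⟨i, hi, hx⟩)
        rw [← hp (Sum.inr y) (Or.inr ⟨i, hi, hy⟩)] at h1
        cases h1
    · rintro hp q (rfl | ⟨i, hi, -⟩)
      · rfl
      · rw [hp] at hi
        cases hi
  have hextra : ∀ P, Extra (lines E F) P ↔ Sum.elim (extend E) (extend F) P = none := by
    rintro ((_ | x) | (_ | x))
    · exact iff_of_true (Or.inl rfl) rfl
    · exact (extra_emb (p := Sum.inl x)).trans (hpt _)
    · exact iff_of_true (Or.inr (Or.inl rfl)) rfl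
    · exact (extra_emb (p := Sum.inr x)).trans (hpt _)
  ext P Q
  change ((Extra (lines E F) P ∧ Extra (lines E F) Q) ∨
    ∃ p q, P = emb p ∧ Q = emb q ∧ lines E F p q) ↔ _ = _
  rw [hextra, hextra]
  constructor
  · rintro (⟨h1, h2⟩ | ⟨p, q, rfl, rfl, (rfl | ⟨i, h1, h2⟩)⟩)
    · rw [h1, h2]
    · rfl
    · rw [hemb, hemb, h1, h2]
  · intro h
    rcases hi : Sum.elim (extend E) (extend F) P with _ | i
    · exact Or.inl ⟨rfl, h ▸ hi⟩
    · right
      have key : ∀ R, Sum.elim (extend E) (extend F) R = some i → ∃ r, R = emb r := by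
        intro R hR
        rcases emb_or_extra (lines E F) R with hr | hr
        · exact hr
        · rw [hextra, hR] at hr
          cases hr
      obtain ⟨p, rfl⟩ := key P hi
      obtain ⟨q, rfl⟩ := key Q (h ▸ hi)
      rw [hemb, hemb] at h
      rw [hemb] at hi
      exact ⟨p, q, rfl, rfl, Or.inr ⟨i, hi, h ▸ hi⟩⟩

theorem starMul_lines {q : Y → Option Z} {E F G : X → Option Y} (hE : IsFrame E) (hF : IsFrame F)
    (hG : IsFrame G) (hq : IsFrame q) :
    starMul (lines (bindLabel q E) (bindLabel q F)) (lines F G) =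
      lines (bindLabel q E) (bindLabel q G) := by
  have hext : ∀ E : X → Option Y, extend (bindLabel q E) = (fun i : Option Y => i.bind q) ∘ extend E := by
    intro E
    funext P
    rcases P with _ | x <;> rfl
  rw [← unbar_bar (lines (bindLabel q E) (bindLabel q G)), starMul, bar_lines hF hG,
    bar_lines (hE.bindLabel hq) (hF.bindLabel hq), bar_lines (hE.bindLabel hq) (hG.bindLabel hq),
    hext, hext, hext, natMul_ker]
  intro z
  rcases hz : extend G z with _ | i
  · exact ⟨none, rfl⟩
  · obtain ⟨y, hy⟩ := hF i
    exact ⟨some y, hy⟩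

theorem mem_genLines_lines {E F : X → Option Y} (hE : IsFrame E) (hF : IsFrame F)
    {A : Set (X ⊕ X)} : A ∈ genLines (lines E F) ↔ ∃ i, A = {p | Sum.elim E F p = some i} := by
  constructor
  · intro hA
    obtain ⟨i, hi⟩ := (lineEquiv hE hF).surjective ⟨A, hA⟩
    exact ⟨i, (congrArg Subtype.val hi).symm⟩
  · rintro ⟨i, rfl⟩
    exact (lineEquiv hE hF i).2

/-- Here `q` may drop labels but not identify them: a merged line fits no single line of the second
factor under `∘`. -/
theorem circMul_lines {q : Y → Option Z} {E F G : X → Option Y} (hE : IsFrame E) (hF : IsFrame F)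
    (hG : IsFrame G) (hq : IsFrame q) (hq' : ∀ i j c, q i = some c → q j = some c → i = j) :
    circMul (lines (bindLabel q E) (bindLabel q F)) (lines F G) =
      lines (bindLabel q E) (bindLabel q G) := by
  refine pointsOrGenLines_ext (pointsOrGenLines_circMul _ _)
    (pointsOrGenLines_lines (hE.bindLabel hq) (hG.bindLabel hq)) fun x z => ?_
  rw [circMul_inl_inr, lines_inl_inr]
  simp only [mem_genLines_lines (hE.bindLabel hq) (hF.bindLabel hq), mem_genLines_lines hF hG]
  constructor
  · rintro ⟨_, ⟨c, rfl⟩, _, ⟨i, rfl⟩, hx, hz, hfit⟩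
    refine ⟨c, hx, bindLabel_eq_some.2 ⟨i, hz, ?_⟩⟩
    obtain ⟨y, hy⟩ := hF i
    obtain ⟨j, hj, hj'⟩ := bindLabel_eq_some.1 ((hfit y).2 hy)
    obtain rfl := Option.some.inj (hy.symm.trans hj)
    exact hj'
  · rintro ⟨c, hx, hz⟩
    obtain ⟨i, hi, hic⟩ := bindLabel_eq_some.1 hz
    refine ⟨_, ⟨c, rfl⟩, _, ⟨i, rfl⟩, hx, hi, fun y => ?_⟩
    change bindLabel q F y = some c ↔ F y = some i
    rw [bindLabel_eq_some]
    constructor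
    · rintro ⟨j, hj, hjc⟩
      rwa [hq' i j c hic hjc]
    · intro hy
      exact ⟨i, hy, hic⟩

end Products

/-! ### Dropping and merging generalised lines -/

theorem exists_drop {m : ℕ} (j : Fin (m + 1)) : ∃ q : Fin (m + 1) → Option (Fin m),
    IsFrame q ∧ (∀ i, q i = none ↔ i = j) ∧ ∀ a b c, q a = some c → q b = some c → a = b := by
  refine ⟨finSuccEquiv' j, fun c => (finSuccEquiv' j).surjective _, fun i => ?_, ?_⟩
  · rw [← finSuccEquiv'_at j]
    exact (finSuccEquiv' j).injective.eq_iff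
  · intro a b c ha hb
    exact (finSuccEquiv' j).injective (ha.trans hb.symm)

theorem exists_merge {m : ℕ} {i j : Fin (m + 1)} (hij : i ≠ j) :
    ∃ q : Fin (m + 1) → Option (Fin m), IsFrame q ∧ (∀ a, q a ≠ none) ∧ q i = q j ∧
      ∀ a b, q a = q b → a = b ∨ (a = i ∨ b = i) ∧ (a = j ∨ b = j) := by
  obtain ⟨q, hq, hj, hinj⟩ := exists_drop j
  obtain ⟨c, hc⟩ := Option.ne_none_iff_exists'.1 (fun h => hij ((hj i).1 h))
  have hval : ∀ a, (a ≠ j ∧ ∃ d, q a = some d) ∨ (a = j ∧ q a = none) := by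
    intro a
    by_cases h : a = j
    · exact Or.inr ⟨h, (hj a).2 h⟩
    · exact Or.inl ⟨h, Option.ne_none_iff_exists'.1 fun h' => h ((hj a).1 h')⟩
  -- Drop `j`, then give it the new label `c` of `i` as default value.
  refine ⟨fun a => some ((q a).getD c), ?_, fun a => Option.some_ne_none _, ?_, ?_⟩
  · intro d
    obtain ⟨a, ha⟩ := hq d
    exact ⟨a, by simp [ha]⟩
  · simp [hc, (hj j).2 rfl]
  · intro a b hab
    rcases hval a with ⟨ha, d, hd⟩ | ⟨ha, hd⟩ <;> rcases hval b with ⟨hb, d', hd'⟩ | ⟨hb, hd'⟩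
    · simp only [hd, hd', Option.getD_some, Option.some_inj] at hab
      exact Or.inl (hinj a b d hd (hab ▸ hd'))
    · simp only [hd, hd', Option.getD_some, Option.getD_none, Option.some_inj] at hab
      exact Or.inr ⟨Or.inl (hinj a i d hd (hab ▸ hc)), Or.inr hb⟩
    · simp only [hd, hd', Option.getD_some, Option.getD_none, Option.some_inj] at hab
      exact Or.inr ⟨Or.inr (hinj b i d' hd' (hab ▸ hc)), Or.inl ha⟩
    · exact Or.inl (ha.trans hb.symm)

section Collapse

variable {X : Type*} {m : ℕ} {E : X → Option (Fin (m + 1))} {π : Equiv.Perm (Fin (m + 1))}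
  {q : Fin (m + 1) → Option (Fin m)}

/-- An upper vertex labelled `j` is a point on the left, but keeps the undropped label `π⁻¹ j` on
the right. -/
theorem lines_drop_ne (hE : IsFrame E) {j : Fin (m + 1)} (hq : ∀ i, q i = none ↔ i = j)
    (hπ : π⁻¹ j ≠ j) : lines (bindLabel q E) (bindLabel q (relabel π E)) ≠
      lines (bindLabel q (relabel π⁻¹ E)) (bindLabel q E) := by
  intro h
  obtain ⟨x, hx⟩ := hE j
  obtain ⟨y, hy⟩ := hE (π⁻¹ j)
  obtain ⟨c, hc⟩ := Option.ne_none_iff_exists'.1 fun h' => hπ ((hq _).1 h')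
  have h1 : lines (bindLabel q (relabel π⁻¹ E)) (bindLabel q E) (Sum.inl x) (Sum.inr y) :=
    lines_inl_inr.2 ⟨c, bindLabel_eq_some.2 ⟨π⁻¹ j, relabel_eq_some.2 (by simpa using hx), hc⟩,
      bindLabel_eq_some.2 ⟨π⁻¹ j, hy, hc⟩⟩
  rw [← h] at h1
  obtain ⟨d, hd, -⟩ := lines_inl_inr.1 h1
  rw [bindLabel, hx, Option.bind_some, (hq j).2 rfl] at hd
  cases hd

/-- Upper vertices labelled `i` and `j` share a block on the left. On the right their labels are
`π⁻¹ i` and `π⁻¹ j`, which are not merged because `π⁻¹ i` is neither `i` nor `j`. -/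
theorem lines_merge_ne (hE : IsFrame E) {i j : Fin (m + 1)} (hij : i ≠ j) (hi : π⁻¹ i ≠ i)
    (hj : π⁻¹ i ≠ j) (hn : ∀ a, q a ≠ none) (hq : q i = q j)
    (hinj : ∀ a b, q a = q b → a = b ∨ (a = i ∨ b = i) ∧ (a = j ∨ b = j)) :
    lines (bindLabel q E) (bindLabel q (relabel π E)) ≠
      lines (bindLabel q (relabel π⁻¹ E)) (bindLabel q E) := by
  intro h
  obtain ⟨x, hx⟩ := hE i
  obtain ⟨y, hy⟩ := hE j
  obtain ⟨c, hc⟩ := Option.ne_none_iff_exists'.1 (hn i)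
  have h1 : lines (bindLabel q E) (bindLabel q (relabel π E)) (Sum.inl x) (Sum.inl y) :=
    Or.inr ⟨c, bindLabel_eq_some.2 ⟨i, hx, hc⟩, bindLabel_eq_some.2 ⟨j, hy, hq ▸ hc⟩⟩
  rw [h] at h1
  rcases h1 with h1 | ⟨d, h1, h2⟩
  · rw [Sum.inl.inj h1, hy] at hx
    exact hij (Option.some.inj hx).symm
  · obtain ⟨a, ha, ha'⟩ := bindLabel_eq_some.1 h1
    obtain ⟨b, hb, hb'⟩ := bindLabel_eq_some.1 h2
    rw [relabel, hx, Option.map_some, Option.some_inj] at ha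
    rw [relabel, hy, Option.map_some, Option.some_inj] at hb
    subst ha hb
    rcases hinj _ _ (ha'.trans hb'.symm) with h3 | ⟨h3 | h3, h4 | h4⟩
    · exact hij (π⁻¹.injective h3)
    · exact hi h3
    · exact hi h3
    · exact hj h4
    · exact hij (h3.symm.trans h4)

variable {S : Type*} [InverseSemigroup S] [PartitionLike S X]

open PartitionLike

theorem mul_eq_of_collapse (inj : Function.Injective (part : S → Setoid (X ⊕ X)))
    (hE : IsFrame E) {e f : S} (he : IsIdempotentElem e) (hf : IsIdempotentElem f)
    (hep : part e = lines E E) (hfp : part f = lines (bindLabel q E) (bindLabel q E))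
    (hmul : ∀ G t, IsFrame G → part t = lines E G →
      part (f * t) = lines (bindLabel q E) (bindLabel q G)) : e * f = f := by
  rw [idem_comm he hf]
  exact inj ((hmul E e hE hep).trans hfp.symm)

theorem mul_ne_of_collapse (hinv : ∀ s : S, part s⁻¹ = flip (part s)) (hE : IsFrame E) {f x : S}
    (hf : IsIdempotentElem f) (hx : part x = lines E (relabel π E))
    (hmul : ∀ G t, IsFrame G → part t = lines E G →
      part (f * t) = lines (bindLabel q E) (bindLabel q G))
    (hne : lines (bindLabel q E) (bindLabel q (relabel π E)) ≠
      lines (bindLabel q (relabel π⁻¹ E)) (bindLabel q E)) : f * x ≠ x * f := by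
  intro h
  have h1 := hmul _ x (hE.relabel π) hx
  have h2 : part x⁻¹ = lines E (relabel π⁻¹ E) := by
    rw [hinv, hx, flip_lines, ← lines_relabel π⁻¹, relabel_relabel, inv_mul_cancel, relabel_one]
  have h3 := hmul _ _ (hE.relabel π⁻¹) h2
  -- Only left multiplication by `f` is described by `hmul`; the product `x * f` is reached through
  -- inverses.
  have h4 : x * f = (f * x⁻¹)⁻¹ := by rw [inv_mul_rev, inv_inv, idem_inv hf]
  exact hne (by rw [← h1, h, h4, hinv, h3, flip_lines])

end Collapse

/-! ### The three semigroups as framed semigroups -/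

open PartitionLike

/-- The case in which all partitions into points and generalised lines occur. -/
abbrev FramedSemigroup.ofPoints {S X : Type*} [InverseSemigroup S] [PartitionLike S X]
    (inj : Function.Injective (part : S → Setoid (X ⊕ X)))
    (range : ∀ α : Setoid (X ⊕ X), (∃ s : S, part s = α) ↔ PointsOrGenLines α)
    (hinv : ∀ s : S, part s⁻¹ = flip (part s))
    (hmul : ∀ {m l : ℕ} {q : Fin m → Option (Fin l)} {E F G : X → Option (Fin m)} {s t : S},
      IsFrame E → IsFrame F → IsFrame G → IsFrame q →
      (∀ i j c, q i = some c → q j = some c → i = j) →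
      part s = lines (bindLabel q E) (bindLabel q F) → part t = lines F G →
        part (s * t) = lines (bindLabel q E) (bindLabel q G)) : FramedSemigroup S X :=
  have hmul' : ∀ {m : ℕ} {E F G : X → Option (Fin m)} {s t : S},
      IsFrame E → IsFrame F → IsFrame G → part s = lines E F → part t = lines F G →
        part (s * t) = lines E G := by
    intro m E F G s t hE hF hG hs ht
    have := hmul (q := some) hE hF hG isFrame_some
      (fun i j c hi hj => Option.some.inj (hi.trans hj.symm))
      (by rwa [bindLabel_some, bindLabel_some]) ht
    rwa [bindLabel_some, bindLabel_some] at this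
  have hdrop : ∀ {m : ℕ} {E : X → Option (Fin (m + 1))} (j : Fin (m + 1)), IsFrame E →
      ∃ q : Fin (m + 1) → Option (Fin m), ∃ f : S, (∀ i, q i = none ↔ i = j) ∧
        IsIdempotentElem f ∧ part f = lines (bindLabel q E) (bindLabel q E) ∧ rk f = m ∧
        ∀ G t, IsFrame G → part t = lines E G →
          part (f * t) = lines (bindLabel q E) (bindLabel q G) := by
    intro m E j hE
    obtain ⟨q, hq, hj, hq'⟩ := exists_drop j
    have hqE := hE.bindLabel hq
    obtain ⟨f, hf⟩ := (range _).2 (pointsOrGenLines_lines hqE hqE)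
    exact ⟨q, f, hj, inj ((hmul' hqE hqE hqE hf hf).trans hf.symm), hf,
      by rw [rk, hf, rank_lines hqE hqE, Nat.card_fin],
      fun G t hG ht => hmul hE hE hG hq hq' hf ht⟩
  { total := False
    minRank := 0
    minRank_le_one := Nat.zero_le _
    nonempty := by
      obtain ⟨s, -⟩ := (range ⊥).2 ((pointsOrGenLines_iff _).2 fun p => Or.inl fun _ h => h.symm)
      exact ⟨s⟩
    minRank_le := fun _ => Nat.zero_le _
    part_injective := inj
    exists_part_iff := fun α => by rw [range, false_imp_iff, and_true]
    part_inv := hinv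
    part_mul := hmul'
    exists_below := by
      intro m E e hE _ he
      obtain ⟨q, f, -, hf, hfp, hfr, hfm⟩ := hdrop 0 hE
      have hei : IsIdempotentElem e := inj ((hmul' hE hE hE he he).trans he.symm)
      exact ⟨f, hf, mul_eq_of_collapse inj hE hei hf he hfp hfm, hfr⟩
    exists_below_moved := by
      intro m E π x hE _ hπ hx
      obtain ⟨j, hj⟩ : ∃ j, π⁻¹ j ≠ j := by
        by_contra! h
        exact hπ (inv_eq_one.1 (Equiv.ext h))
      obtain ⟨q, f, hqj, hf, hfp, hfr, hfm⟩ := hdrop j hE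
      have he : part (x * x⁻¹) = lines E E :=
        hmul' hE (hE.relabel π) hE hx (by rw [hinv, hx, flip_lines])
      exact ⟨f, hf, mul_eq_of_collapse inj hE (idem_mul_inv x) hf he hfp hfm, hfr,
        mul_ne_of_collapse hinv hE hf hx hfm (lines_drop_ne hE hqj hj)⟩ }

instance (X : Type*) : FramedSemigroup (PIStar X) X :=
  .ofPoints Subtype.val_injective
    (fun α => ⟨fun ⟨s, hs⟩ => hs ▸ s.2, fun h => ⟨⟨α, h⟩, rfl⟩⟩)
    (fun _ => rfl)
    (fun {_ _ _ _ _ _ s t} hE hF hG hq _ hs ht => by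
      change starMul s.1 t.1 = _
      rw [← starMul_lines hE hF hG hq, ← hs, ← ht]
      rfl)

instance (X : Type*) : FramedSemigroup (PIBar X) X :=
  .ofPoints Subtype.val_injective
    (fun α => ⟨fun ⟨s, hs⟩ => hs ▸ s.2, fun h => ⟨⟨α, h⟩, rfl⟩⟩)
    (fun _ => rfl)
    (fun {_ _ _ _ _ _ s t} hE hF hG hq hq' hs ht => by
      change circMul s.1 t.1 = _
      rw [← circMul_lines hE hF hG hq hq', ← hs, ← ht]
      rfl)

namespace IStar

variable {X : Type*}

theorem ne_none {m : ℕ} {E F : X → Option (Fin m)} {s : IStar X} (hE : IsFrame E)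
    (hF : IsFrame F) (hs : part s = lines E F) : (∀ x, E x ≠ none) ∧ ∀ x, F x ≠ none :=
  (allGenLines_lines_iff hE hF).1 (hs ▸ s.2)

theorem part_mul_lines {m l : ℕ} {q : Fin m → Option (Fin l)} {E F G : X → Option (Fin m)}
    {s t : IStar X} (hF : IsFrame F) (hG : IsFrame G) (hE : ∀ x, E x ≠ none)
    (hq : ∀ i, q i ≠ none) (hs : part s = lines (bindLabel q E) (bindLabel q F))
    (ht : part t = lines F G) : part (s * t) = lines (bindLabel q E) (bindLabel q G) := by
  obtain ⟨h1, h2⟩ := ne_none hF hG ht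
  change natMul s.1 t.1 = _
  rw [← natMul_lines hE h1 h2 hq hF, ← hs, ← ht]
  rfl

theorem part_mul {m : ℕ} {E F G : X → Option (Fin m)} {s t : IStar X} (hE : IsFrame E)
    (hF : IsFrame F) (hG : IsFrame G) (hs : part s = lines E F) (ht : part t = lines F G) :
    part (s * t) = lines E G := by
  have := part_mul_lines (q := some) hF hG (ne_none hE hF hs).1 (fun i => Option.some_ne_none i)
    (by rwa [bindLabel_some, bindLabel_some]) ht
  rwa [bindLabel_some, bindLabel_some] at this

theorem exists_collapse {m : ℕ} {E : X → Option (Fin (m + 1))} (hE : IsFrame E)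
    (hn : ∀ x, E x ≠ none) {q : Fin (m + 1) → Option (Fin m)} (hq : IsFrame q)
    (hqn : ∀ i, q i ≠ none) :
    ∃ f : IStar X, IsIdempotentElem f ∧ part f = lines (bindLabel q E) (bindLabel q E) ∧ rk f = m ∧
      ∀ G t, IsFrame G → part t = lines E G →
        part (f * t) = lines (bindLabel q E) (bindLabel q G) := by
  have hqE := hE.bindLabel hq
  have hqE' := bindLabel_ne_none hn hqn
  let f : IStar X := ⟨lines (bindLabel q E) (bindLabel q E),
    (allGenLines_lines_iff hqE hqE).2 ⟨hqE', hqE'⟩⟩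
  have hf : part f = lines (bindLabel q E) (bindLabel q E) := rfl
  exact ⟨f, Subtype.ext (part_mul hqE hqE hqE hf hf), hf,
    by rw [rk, hf, rank_lines hqE hqE, Nat.card_fin],
    fun G t hG ht => part_mul_lines hE hG hn hqn hf ht⟩

end IStar

instance (X : Type*) [Finite X] [Nonempty X] : FramedSemigroup (IStar X) X where
  total := True
  minRank := 1
  minRank_le_one := le_rfl
  nonempty := by
    obtain ⟨x⟩ := ‹Nonempty X›
    exact ⟨⊤, (allGenLines_iff _).2 fun p => ⟨⟨x, trivial⟩, ⟨x, trivial⟩⟩⟩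
  minRank_le s := by
    obtain ⟨x⟩ := ‹Nonempty X›
    have h := Setoid.mem_classes s.1 (Sum.inl x)
    exact (Set.ncard_pos (Set.toFinite _)).2 ⟨_, h, s.2 _ h⟩
  part_injective := Subtype.val_injective
  exists_part_iff α := ⟨fun ⟨s, hs⟩ => hs ▸ ⟨s.2.pointsOrGenLines, fun _ => s.2⟩,
    fun h => ⟨⟨α, h.2 trivial⟩, rfl⟩⟩
  part_inv _ := rfl
  part_mul := IStar.part_mul
  exists_below := by
    intro m E e hE hm he
    -- Since `1 ≤ m`, the labels `0` and `m` are distinct and can be merged.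
    obtain ⟨q, hq, hqn, -, -⟩ := exists_merge (i := 0) (j := Fin.last m)
      (fun h => by have := congrArg Fin.val h; simp at this; omega)
    obtain ⟨f, hf, hfp, hfr, hfm⟩ := IStar.exists_collapse hE (IStar.ne_none hE hE he).1 hq hqn
    have hei : IsIdempotentElem e := Subtype.ext ((IStar.part_mul hE hE hE he he).trans he.symm)
    exact ⟨f, hf, mul_eq_of_collapse Subtype.val_injective hE hei hf he hfp hfm, hfr⟩
  exists_below_moved := by
    intro m E π x hE hm hπ hx
    obtain ⟨i, hi⟩ : ∃ i, π⁻¹ i ≠ i := by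
      by_contra! h
      exact hπ (inv_eq_one.1 (Equiv.ext h))
    -- The bound on `m` gives at least three labels, so one is left to merge with `i`.
    obtain ⟨j, hj⟩ : ∃ j, j ∉ ({i, π⁻¹ i} : Finset (Fin (m + 1))) := by
      by_contra! h
      have h1 := Finset.card_le_card (fun j _ => h j : Finset.univ ⊆ {i, π⁻¹ i})
      have h2 := Finset.card_le_two (a := i) (b := π⁻¹ i)
      rw [Finset.card_univ, Fintype.card_fin] at h1
      omega
    simp only [Finset.mem_insert, Finset.mem_singleton, not_or] at hj
    obtain ⟨q, hq, hqn, hqij, hinj⟩ := exists_merge (Ne.symm hj.1)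
    obtain ⟨f, hf, hfp, hfr, hfm⟩ :=
      IStar.exists_collapse hE (IStar.ne_none hE (hE.relabel π) hx).1 hq hqn
    have he : part (x * x⁻¹) = lines E E :=
      IStar.part_mul hE (hE.relabel π) hE hx ((congrArg flip hx).trans (flip_lines _ _))
    exact ⟨f, hf, mul_eq_of_collapse Subtype.val_injective hE (idem_mul_inv x) hf he hfp hfm, hfr,
      mul_ne_of_collapse (fun _ => rfl) hE hf hx hfm
        (lines_merge_ne hE (Ne.symm hj.1) hi (Ne.symm hj.2) hqn hqij hinj)⟩

/-- By `relF_iff` both relations depend only on the underlying partitions, although Green's relation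
and `x * y⁻¹` in their definition refer to different products. -/
theorem relRho_toBar {X : Type*} [Finite X] {k : ℕ} {A : Subgroup (Equiv.Perm (Fin (k + 1)))}
    (hA : A.Normal) (a b : PIStar X) :
    relRho (PIBar X) A (PIStar.toBar a) (PIStar.toBar b) ↔ relRho (PIStar X) A a b := by
  have hbr : ∀ (a : PIStar X) (E F : X → Option (Fin (k + 1))), Br (PIStar.toBar a) E F ↔ Br a E F :=
    fun a E F => ⟨fun h => ⟨h.1, h.2, h.3⟩, fun h => ⟨h.1, h.2, h.3⟩⟩
  rw [relRho, relRho, relF_iff hA, relF_iff hA]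
  simp only [hbr]
  exact Iff.rfl

end PartitionSemigroups

/-! ### The classification theorems -/

open PartitionSemigroups in
theorem mainTheorem1 (n : ℕ) (hn : 1 ≤ n) :
    -- congruences on `I*_n`
    (∀ ρ : IStar (Fin n) → IStar (Fin n) → Prop,
      IsCongruence ρ ↔
        ∃ k, 1 ≤ k ∧ k ≤ n ∧ ∃ A : Subgroup (Equiv.Perm (Fin (k + 1))), A.Normal ∧
          ρ = relRho (IStar (Fin n)) A) ∧
    -- congruence pairs of `I*_n`
    (∀ (K : Subsemigroup (IStar (Fin n))) (Λ : IStar (Fin n) → IStar (Fin n) → Prop),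
      IsNormalSubsemigroup K → IsNormalCongruence Λ →
        (IsCongruencePair K Λ ↔
          ∃ k, 1 ≤ k ∧ k ≤ n ∧ Λ = relLambda (IStar (Fin n)) k ∧
            ∃ A : Subgroup (Equiv.Perm (Fin (k + 1))), A.Normal ∧
              (K : Set (IStar (Fin n))) = kernelSet (IStar (Fin n)) A)) ∧
    -- congruence pairs of `PI*_n`
    (∀ (K : Subsemigroup (PIStar (Fin n))) (Λ : PIStar (Fin n) → PIStar (Fin n) → Prop),
      IsNormalSubsemigroup K → IsNormalCongruence Λ →
        (IsCongruencePair K Λ ↔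
          ∃ k, k ≤ n ∧ Λ = relLambda (PIStar (Fin n)) k ∧
            ∃ A : Subgroup (Equiv.Perm (Fin (k + 1))), A.Normal ∧
              (K : Set (PIStar (Fin n))) = kernelSet (PIStar (Fin n)) A)) ∧
    -- congruences on `PI*_n`
    (∀ ρ : PIStar (Fin n) → PIStar (Fin n) → Prop,
      IsCongruence ρ ↔
        ∃ k, k ≤ n ∧ ∃ A : Subgroup (Equiv.Perm (Fin (k + 1))), A.Normal ∧
          ρ = relRho (PIStar (Fin n)) A) ∧
    -- congruences on the semigroup with the multiplication `∘`
    (∀ ρ : PIBar (Fin n) → PIBar (Fin n) → Prop,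
      IsCongruence ρ ↔
        ∃ k, k ≤ n ∧ ∃ A : Subgroup (Equiv.Perm (Fin (k + 1))), A.Normal ∧
          ρ = relRho (PIBar (Fin n)) A) ∧
    -- the last two semigroups have the same congruences
    (∀ ρ : PIBar (Fin n) → PIBar (Fin n) → Prop,
      IsCongruence ρ ↔
        IsCongruence fun a b : PIStar (Fin n) => ρ (PIStar.toBar a) (PIStar.toBar b)) := by
  have : Nonempty (Fin n) := ⟨⟨0, hn⟩⟩
  have hc : Nat.card (Fin n) = n := Nat.card_fin n
  have h4 : ∀ ρ : PIStar (Fin n) → PIStar (Fin n) → Prop, IsCongruence ρ ↔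
      ∃ k, k ≤ n ∧ ∃ A : Subgroup (Equiv.Perm (Fin (k + 1))), A.Normal ∧
        ρ = relRho (PIStar (Fin n)) A := by
    intro ρ
    refine isCongruence_iff.trans (exists_congr fun k => ?_)
    rw [hc]
    -- The minimal rank unfolds to 0 here; for `IStar` it unfolds to 1, which is the bound `1 ≤ k`.
    exact and_iff_right (Nat.zero_le k)
  have h5 : ∀ ρ : PIBar (Fin n) → PIBar (Fin n) → Prop, IsCongruence ρ ↔
      ∃ k, k ≤ n ∧ ∃ A : Subgroup (Equiv.Perm (Fin (k + 1))), A.Normal ∧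
        ρ = relRho (PIBar (Fin n)) A := by
    intro ρ
    refine isCongruence_iff.trans (exists_congr fun k => ?_)
    rw [hc]
    exact and_iff_right (Nat.zero_le k)
  refine ⟨fun ρ => ?_, fun K Λ hK hΛ => ?_, fun K Λ hK hΛ => ?_, h4, h5, fun ρ => ?_⟩
  · refine isCongruence_iff.trans (exists_congr fun k => ?_)
    rw [hc]
    exact Iff.rfl
  · refine (isCongruencePair_iff hK hΛ).trans (exists_congr fun k => ?_)
    rw [hc]
    exact Iff.rfl
  · refine (isCongruencePair_iff hK hΛ).trans (exists_congr fun k => ?_)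
    rw [hc]
    exact and_iff_right (Nat.zero_le k)
  · rw [h4, h5]
    refine exists_congr fun k => and_congr_right fun _ => exists_congr fun A =>
      and_congr_right fun hA => ?_
    constructor
    · rintro rfl
      funext a b
      exact propext (relRho_toBar hA a b)
    · intro h
      funext a b
      exact (congrFun (congrFun h a) b).trans (propext (relRho_toBar hA _ _)).symm
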